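/- Let $t^0=\tfrac12\mathrm{diag}(1,-1)$, $t^+=E_{12}$, $t^-=E_{21}$ be the basis of $\mathfrak{sl}_2(\mathbb C)$ with $[t^0,t^\pm]=\pm t^\pm$, $[t^+,t^-]=2t^0$. Write $[t^a,t^b]=f^{ab}_c t^c$ (repeated indices are summed over $0,+,-$), $K^{ab}=\mathrm{tr}(t^at^b)$ (so $K^{00}=\tfrac12$, $K^{+-}=K^{-+}=1$), let $K_{ab}$ be the inverse matrix, and put $f^c_{ab}=K_{aa'}f^{ca'}_b$. Let $\hat{\mathfrak{sl}}_2$ be the affine Lie algebra, spanned by $J^a_n$ ($a\in\{0,+,-\}$, $n\in\mathbb Z$) and a central element $\mathbf k$, with $$[J^a_n,J^b_m]=f^{ab}_c J^c_{n+m}+n\,K^{ab}\,\delta_{n+m,0}\,\mathbf k ,$$ and let $U$ be its universal enveloping algebra. Let $k,j\in\mathbb C$ and $t=k+2$, and suppose that $t\neq 0$ and $2j(j+1)=\frac{t^2}{2}-t$. Let $C_2=K_{ab}J^a_0J^b_0$. The null vector space is the left $U$-module $$M=U/(W_1+W_2+W_c),\qquad W_1=\sum_{a,\;n>0}U J^a_n,\quad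 W_2=U\,(C_2-2j(j+1)),\quad W_c=U\,(\mathbf k-k).$$ Its level-$1$ part is the span of the classes of the products $\prod_i J^{a_i}_{n_i}$ with $-\sum_i n_i=1$, and its charge-zero eigenspace $E^0$ is the kernel of the adjoint action $[J^0_0,\,\cdot\,]$ on $M$. An element $\hat T\in M$ is called a null operator if $J^a_1\hat T=0$ for every $a\in\{0,+,-\}$. Let $$\hat T^0_1=2K_{ab}J^a_{-1}J^b_0J^0_0-t\,f^0_{ab}J^a_{-1}J^b_0-t^2J^0_{-1}.$$ Then an element $\hat T$ of $M$ is a null operator lying in the level-$1$ part and in $E^0$ if and only if $\hat T=\hat T^0_1\cdot p(J^0_0)$ in $M$ for some polynomial $p\in\mathbb C[X]$. -/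

import Mathlib

open scoped TensorProduct

namespace AffineSl2

noncomputable section

/-- The Lie algebra `sl₂(ℂ)` of traceless complex `2 × 2` matrices. -/
abbrev Sl2 : Type := LieAlgebra.SpecialLinear.sl (Fin 2) ℂ

/-- Labels of the basis `t⁰, t⁺, t⁻` of `sl₂`. -/
inductive Idx : Type
  | zero
  | plus
  | minus
  deriving DecidableEq

instance : Fintype Idx where
  elems := ⟨[Idx.zero, Idx.plus, Idx.minus], by simp⟩
  complete := by intro x; cases x <;> simp

lemma sum_idx {M : Type*} [AddCommMonoid M] (g : Idx → M) :
    ∑ a, g a = g .zero + g .plus + g .minus := by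
  have h : (Finset.univ : Finset Idx) = {.zero, .plus, .minus} := by
    ext x; cases x <;> simp
  rw [h]
  simp [add_assoc]

/-- The basis `t⁰ = diag(1/2, -1/2)`, `t⁺ = E₁₂`, `t⁻ = E₂₁` of `sl₂`, for which
`[t⁰, t^±] = ± t^±` and `[t⁺, t⁻] = 2 t⁰`. -/
def gen : Idx → Sl2
  | .zero => ⟨!![1 / 2, 0; 0, -1 / 2], by
      simp [LieAlgebra.SpecialLinear.sl, Matrix.trace_fin_two]; norm_num⟩
  | .plus => ⟨!![0, 1; 0, 0], by simp [LieAlgebra.SpecialLinear.sl, Matrix.trace_fin_two]⟩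
  | .minus => ⟨!![0, 0; 1, 0], by simp [LieAlgebra.SpecialLinear.sl, Matrix.trace_fin_two]⟩

/-- The normalised Killing form (one quarter of the Killing form of `sl₂`), i.e. the trace form
`(X, Y) ↦ tr (X Y)`. -/
def form : LinearMap.BilinForm ℂ Sl2 :=
  LinearMap.mk₂ ℂ (fun X Y : Sl2 => Matrix.trace (X.1 * Y.1))
    (by intro X X' Y; simp [add_mul])
    (by intro c X Y; simp)
    (by intro X Y Y'; simp [mul_add])
    (by intro c X Y; simp)

lemma form_apply (X Y : Sl2) : form X Y = Matrix.trace (X.1 * Y.1) := rfl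

lemma form_isSymm : form.IsSymm :=
  ⟨fun X Y => by simp [form_apply, Matrix.trace_mul_comm X.1 Y.1]⟩

lemma form_lieInvariant : form.lieInvariant Sl2 := by
  intro X Y Z
  have h := Matrix.trace_mul_cycle X.1 Y.1 Z.1
  have h2 := Matrix.trace_mul_cycle Y.1 X.1 Z.1
  have h3 := Matrix.trace_mul_cycle Z.1 Y.1 X.1
  simp only [form_apply, LieSubalgebra.coe_bracket, Ring.lie_def, sub_mul, mul_sub,
    Matrix.trace_sub, ← mul_assoc]
  rw [h2, h3, h, ← h]
  rw [Matrix.trace_mul_cycle X.1 Y.1 Z.1, Matrix.trace_mul_cycle Z.1 X.1 Y.1]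
  ring

/-- `K^{ab}`, the form in the basis `t^a`. -/
def Kup (a b : Idx) : ℂ := form (gen a) (gen b)

/-- `K_{ab}`, the inverse matrix of `K^{ab}`. -/
def Klow : Idx → Idx → ℂ
  | .zero, .zero => 2
  | .plus, .minus => 1
  | .minus, .plus => 1
  | _, _ => 0

/-- The structure constants `f^{ab}_c`, i.e. `[t^a, t^b] = ∑ c, f^{ab}_c t^c`. -/
def fstr : Idx → Idx → Idx → ℂ
  | .zero, .plus, .plus => 1
  | .plus, .zero, .plus => -1
  | .zero, .minus, .minus => -1
  | .minus, .zero, .minus => 1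
  | .plus, .minus, .zero => 2
  | .minus, .plus, .zero => -2
  | _, _, _ => 0

/-- The structure constants `f^c_{ab}`, obtained by lowering the second index of `f^{ca'}_b`. -/
def fLow (c a b : Idx) : ℂ := ∑ a' : Idx, Klow a a' * fstr c a' b

/-- The cocycle of the affine Lie algebra. Mathlib's residue pairing of `x ⊗ zⁿ` and `y ⊗ zᵐ` is
`m (x, y) δ_{n+m,0} = - n (x, y) δ_{n+m,0}`, hence the sign in front of the form. -/
abbrev cocycle : LieModule.Cohomology.twoCocycle ℂ (LieAlgebra.loopAlgebra ℂ ℤ Sl2)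
    (TrivialLieModule ℂ (LieAlgebra.loopAlgebra ℂ ℤ Sl2) ℂ) :=
  LieAlgebra.LoopAlgebra.twoCocycleOfBilinear ℂ ℤ Sl2 (-form)
    (by intro X Y Z
        have := form_lieInvariant X Y Z
        simp only [LinearMap.neg_apply, this])
    ⟨fun X Y => by
        have := form_isSymm.eq X Y
        simp only [LinearMap.neg_apply] at this ⊢
        rw [this]⟩

/-- The affine Lie algebra `sl₂^`, the central extension of the loop algebra `sl₂ ⊗ ℂ[z, z⁻¹]`. -/
abbrev Affine : Type := LieAlgebra.ofTwoCocycle cocycle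

/-- The generator `J^a_n = t^a ⊗ zⁿ` of the affine Lie algebra. -/
def J (a : Idx) (n : ℤ) : Affine :=
  LieAlgebra.ofProd cocycle (AddMonoidAlgebra.single n 1 ⊗ₜ[ℂ] gen a, 0)

/-- The central element of the affine Lie algebra. -/
def central : Affine :=
  LieAlgebra.ofProd cocycle (0, (TrivialLieModule.equiv ℂ _ ℂ).symm 1)

lemma gen_lie (a b : Idx) : ⁅gen a, gen b⁆ = ∑ c, fstr a b c • gen c := by
  rw [sum_idx]
  apply Subtype.ext
  cases a <;> cases b <;>
    (ext i j; fin_cases i <;> fin_cases j <;>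
      simp [gen, fstr, Ring.lie_def] <;> norm_num)

/-- `K_{ab}` and `K^{ab}` are inverse to each other. -/
lemma Klow_Kup (a c : Idx) : ∑ b, Klow a b * Kup b c = if a = c then 1 else 0 := by
  rw [sum_idx]
  cases a <;> cases c <;>
    (simp [Klow, Kup, form_apply, gen, Matrix.trace_fin_two]; try norm_num)

/-- The commutation relations of the affine Lie algebra. -/
lemma J_lie (a b : Idx) (n m : ℤ) :
    ⁅J a n, J b m⁆ = ∑ c, fstr a b c • J c (n + m) +
      (if n + m = 0 then (n : ℂ) * Kup a b else 0) • central := by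
  have h1 : ⁅(AddMonoidAlgebra.single n (1 : ℂ) ⊗ₜ[ℂ] gen a : LieAlgebra.loopAlgebra ℂ ℤ Sl2),
      (AddMonoidAlgebra.single m (1 : ℂ) ⊗ₜ[ℂ] gen b : LieAlgebra.loopAlgebra ℂ ℤ Sl2)⁆ =
      ∑ c, fstr a b c • (AddMonoidAlgebra.single (n + m) (1 : ℂ) ⊗ₜ[ℂ] gen c) := by
    rw [LieAlgebra.ExtendScalars.bracket_tmul, gen_lie, TensorProduct.tmul_sum,
      AddMonoidAlgebra.single_mul_single, one_mul]
    simp only [TensorProduct.tmul_smul]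
  have h2 : LieAlgebra.LoopAlgebra.residuePairing ℂ ℤ Sl2 (-form)
      (AddMonoidAlgebra.single n (1 : ℂ) ⊗ₜ[ℂ] gen a)
      (AddMonoidAlgebra.single m (1 : ℂ) ⊗ₜ[ℂ] gen b) =
      if n + m = 0 then (n : ℂ) * Kup a b else 0 := by
    rw [LieAlgebra.LoopAlgebra.residuePairing_apply_apply,
      LieAlgebra.LoopAlgebra.toFinsupp_single_tmul, LieAlgebra.LoopAlgebra.toFinsupp_single_tmul,
      Finsupp.sum_single_index (by simp)]
    by_cases h : n + m = 0
    · obtain rfl : m = -n := by omega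
      simp [Kup]
    · rw [Finsupp.single_eq_of_ne (by omega)]
      simp [h]
  have h3 : ⁅J a n, J b m⁆ = LieAlgebra.ofProd cocycle
      (⁅(AddMonoidAlgebra.single n (1 : ℂ) ⊗ₜ[ℂ] gen a : LieAlgebra.loopAlgebra ℂ ℤ Sl2),
        (AddMonoidAlgebra.single m (1 : ℂ) ⊗ₜ[ℂ] gen b : LieAlgebra.loopAlgebra ℂ ℤ Sl2)⁆,
      (TrivialLieModule.equiv ℂ _ ℂ).symm (LieAlgebra.LoopAlgebra.residuePairing ℂ ℤ Sl2 (-form)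
      (AddMonoidAlgebra.single n (1 : ℂ) ⊗ₜ[ℂ] gen a)
      (AddMonoidAlgebra.single m (1 : ℂ) ⊗ₜ[ℂ] gen b)) + 0 - 0) := rfl
  rw [h3, h1, h2, add_zero, sub_zero]
  have h4 : ∀ r : ℂ, (TrivialLieModule.equiv ℂ (LieAlgebra.loopAlgebra ℂ ℤ Sl2) ℂ).symm r =
      r • (TrivialLieModule.equiv ℂ (LieAlgebra.loopAlgebra ℂ ℤ Sl2) ℂ).symm 1 := by
    intro r; rw [← map_smul]; simp
  rw [h4, sum_idx, sum_idx]
  simp only [J, central, ← LieAlgebra.of_smul, ← LieAlgebra.of_add, Prod.smul_mk, Prod.mk_add_mk,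
    smul_zero, add_zero, zero_add]

/-- The universal enveloping algebra of the affine Lie algebra. -/
abbrev U : Type := UniversalEnvelopingAlgebra ℂ Affine

/-- `J^a_n` as an element of the universal enveloping algebra. -/
def JU (a : Idx) (n : ℤ) : U := UniversalEnvelopingAlgebra.ι ℂ (J a n)

/-- The central element as an element of the universal enveloping algebra. -/
def centralU : U := UniversalEnvelopingAlgebra.ι ℂ central

/-- The quadratic Casimir element `C₂ = K_{ab} J^a_0 J^b_0` of the horizontal algebra. -/
def casimir : U := ∑ a, ∑ b, Klow a b • (JU a 0 * JU b 0)

lemma JU_mul (a b : Idx) (n m : ℤ) :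
    JU a n * JU b m = JU b m * JU a n + (∑ c, fstr a b c • JU c (n + m) +
      (if n + m = 0 then (n : ℂ) * Kup a b else 0) • centralU) := by
  let _ : LieRing U := LieRing.ofAssociativeRing
  have h := congrArg (UniversalEnvelopingAlgebra.ι ℂ) (J_lie a b n m)
  rw [LieHom.map_lie, LieRing.of_associative_ring_bracket, sub_eq_iff_eq_add'] at h
  simpa only [map_add, map_sum, map_smul, JU, centralU] using h

lemma centralU_comm (a : Idx) (n : ℤ) : centralU * JU a n = JU a n * centralU := by
  have h0 : ⁅central, J a n⁆ = 0 := by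
    have h3 : ⁅central, J a n⁆ = LieAlgebra.ofProd cocycle
        (⁅(0 : LieAlgebra.loopAlgebra ℂ ℤ Sl2),
          (AddMonoidAlgebra.single n (1 : ℂ) ⊗ₜ[ℂ] gen a : LieAlgebra.loopAlgebra ℂ ℤ Sl2)⁆,
        (TrivialLieModule.equiv ℂ _ ℂ).symm (LieAlgebra.LoopAlgebra.residuePairing ℂ ℤ Sl2 (-form)
        0 (AddMonoidAlgebra.single n (1 : ℂ) ⊗ₜ[ℂ] gen a)) + 0 - 0) := rfl
    have h4 : ⁅(0 : LieAlgebra.loopAlgebra ℂ ℤ Sl2), (AddMonoidAlgebra.single n (1 : ℂ) ⊗ₜ[ℂ] gen a :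
        LieAlgebra.loopAlgebra ℂ ℤ Sl2)⁆ = 0 := by
      have h5 : (0 : LieAlgebra.loopAlgebra ℂ ℤ Sl2) =
          (0 : AddMonoidAlgebra ℂ ℤ) ⊗ₜ[ℂ] (0 : Sl2) := (TensorProduct.zero_tmul _ _).symm
      rw [h5, LieAlgebra.ExtendScalars.bracket_tmul, zero_mul, TensorProduct.zero_tmul,
        TensorProduct.zero_tmul]
    rw [h3, h4, map_zero, LinearMap.zero_apply, map_zero, add_zero, sub_zero]
    rfl
  let _ : LieRing U := LieRing.ofAssociativeRing
  have h := congrArg (UniversalEnvelopingAlgebra.ι ℂ) h0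
  rwa [LieHom.map_lie, LieRing.of_associative_ring_bracket, map_zero, sub_eq_zero] at h

lemma casimir_comm : casimir * JU .zero 0 = JU .zero 0 * casimir := by
  have hp := JU_mul .plus .zero 0 0
  have hm := JU_mul .minus .zero 0 0
  simp only [sum_idx, fstr, Int.cast_zero, zero_mul, ite_self, zero_smul, add_zero, zero_add,
    one_smul, neg_smul] at hp hm
  simp only [casimir, sum_idx, Klow, zero_smul, add_zero, zero_add, one_smul, add_mul, mul_add,
    smul_mul_assoc, mul_smul_comm]
  have h1 : JU .plus 0 * JU .minus 0 * JU .zero 0 = JU .zero 0 * (JU .plus 0 * JU .minus 0) := by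
    rw [mul_assoc, hm, mul_add, ← mul_assoc, hp]
    noncomm_ring
  have h2 : JU .minus 0 * JU .plus 0 * JU .zero 0 = JU .zero 0 * (JU .minus 0 * JU .plus 0) := by
    rw [mul_assoc, hp, mul_add, ← mul_assoc, hm]
    noncomm_ring
  rw [h1, h2, mul_assoc]

/-- The left ideal spanned by `U J^a_n` with `n > 0`. -/
def W₁ : Submodule U U := Submodule.span U {x | ∃ (a : Idx) (n : ℤ), 0 < n ∧ x = JU a n}

/-- The left ideal `U (C₂ - 2 j (j + 1))`. -/
def W₂ (j : ℂ) : Submodule U U :=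
  Submodule.span U {casimir - algebraMap ℂ U (2 * j * (j + 1))}

/-- The left ideal by which the central element becomes the number `k`, the level. -/
def Wc (k : ℂ) : Submodule U U :=
  Submodule.span U {centralU - algebraMap ℂ U k}

/-- The null vector space at level `k`, with Casimir value `2 j (j + 1)`. -/
abbrev NullVectorSpace (k j : ℂ) : Type := U ⧸ (W₁ ⊔ W₂ j ⊔ Wc k)

/-- The class of an element of the universal enveloping algebra in the null vector space. -/
def cls (k j : ℂ) : U →ₗ[U] NullVectorSpace k j := Submodule.mkQ _

/-- `T` is a null operator if `J^a_1 T = 0` for all `a`. -/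
def IsNullOperator {k j : ℂ} (T : NullVectorSpace k j) : Prop := ∀ a : Idx, JU a 1 • T = 0

/-- The commutator `u ↦ [J^0_0, u]` on the universal enveloping algebra. -/
def adU : U →ₗ[ℂ] U :=
  LinearMap.mulLeft ℂ (JU .zero 0) - LinearMap.mulRight ℂ (JU .zero 0)

lemma adU_mem (k j : ℂ) : (W₁ ⊔ W₂ j ⊔ Wc k).restrictScalars ℂ ≤
    ((W₁ ⊔ W₂ j ⊔ Wc k).restrictScalars ℂ).comap adU := by
  have key : ∀ u ∈ W₁ ⊔ W₂ j ⊔ Wc k, u * JU .zero 0 ∈ W₁ ⊔ W₂ j ⊔ Wc k := by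
    have hW1 : ∀ (a : Idx) (n : ℤ), 0 < n → JU a n ∈ W₁ ⊔ W₂ j ⊔ Wc k := fun a n hn =>
      Submodule.mem_sup_left (Submodule.mem_sup_left (Submodule.subset_span ⟨a, n, hn, rfl⟩))
    have hspan : ∀ S : Set U, (∀ x ∈ S, x * JU .zero 0 ∈ W₁ ⊔ W₂ j ⊔ Wc k) →
        ∀ u ∈ Submodule.span U S, u * JU .zero 0 ∈ W₁ ⊔ W₂ j ⊔ Wc k := by
      intro S hS u hu
      induction hu using Submodule.span_induction with
      | mem x hx => exact hS x hx
      | zero => simp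
      | add x y _ _ hx hy => rw [add_mul]; exact Submodule.add_mem _ hx hy
      | smul r x _ hx =>
        rw [smul_eq_mul, mul_assoc]
        exact Submodule.smul_mem _ r hx
    intro u hu
    obtain ⟨v, hv, w, hw, rfl⟩ := Submodule.mem_sup.1 hu
    obtain ⟨x, hx, y, hy, rfl⟩ := Submodule.mem_sup.1 hv
    rw [add_mul, add_mul]
    refine Submodule.add_mem _ (Submodule.add_mem _ (hspan _ ?_ x hx) (hspan _ ?_ y hy))
      (hspan _ ?_ w hw)
    · rintro _ ⟨a, n, hn, rfl⟩
      rw [JU_mul]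
      refine Submodule.add_mem _ (Submodule.smul_mem _ _ (hW1 a n hn)) ?_
      rw [if_neg (by omega), zero_smul, add_zero, add_zero]
      refine Submodule.sum_mem _ fun c _ => ?_
      exact Submodule.smul_of_tower_mem _ _ (hW1 c n hn)
    · rintro _ rfl
      have hc : (casimir - algebraMap ℂ U (2 * j * (j + 1))) * JU .zero 0 =
          JU .zero 0 • (casimir - algebraMap ℂ U (2 * j * (j + 1))) := by
        rw [sub_mul, smul_eq_mul, mul_sub, casimir_comm, Algebra.commutes]
      rw [hc]
      exact Submodule.smul_mem _ _ (Submodule.mem_sup_left (Submodule.mem_sup_right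
        (Submodule.subset_span rfl)))
    · rintro _ rfl
      have hc : (centralU - algebraMap ℂ U k) * JU .zero 0 =
          JU .zero 0 • (centralU - algebraMap ℂ U k) := by
        rw [sub_mul, smul_eq_mul, mul_sub, centralU_comm, Algebra.commutes]
      rw [hc]
      exact Submodule.smul_mem _ _ (Submodule.mem_sup_right (Submodule.subset_span rfl))
  intro u hu
  exact Submodule.sub_mem _ (Submodule.smul_mem (W₁ ⊔ W₂ j ⊔ Wc k) (JU .zero 0) hu) (key u hu)

/-- The adjoint action `[J^0_0, ·]` on the null vector space. -/
def ad (k j : ℂ) : Module.End ℂ (NullVectorSpace k j) :=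
  Submodule.mapQ ((W₁ ⊔ W₂ j ⊔ Wc k).restrictScalars ℂ)
    ((W₁ ⊔ W₂ j ⊔ Wc k).restrictScalars ℂ) adU (adU_mem k j)

/-- The eigenspace `E^Q` of charge `Q`. -/
def chargeSpace (k j Q : ℂ) : Submodule ℂ (NullVectorSpace k j) := (ad k j).eigenspace Q

/-- The subspace of level (of descendence) `N`: the span of the classes of the products
`∏ᵢ J^{aᵢ}_{nᵢ}` with `-∑ᵢ nᵢ = N`. -/
def levelSpace (k j : ℂ) (N : ℤ) : Submodule ℂ (NullVectorSpace k j) :=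
  Submodule.span ℂ {T | ∃ l : List (Idx × ℤ), -(l.map Prod.snd).sum = N ∧
    T = cls k j (l.map fun x => JU x.1 x.2).prod}

/-- `T̂₁^c = 2 K_{ab} J^a_{-1} J^b_0 J^c_0 - t f^c_{ab} J^a_{-1} J^b_0 - t² J^c_{-1}`. -/
def T₁ (t : ℂ) (c : Idx) : U :=
  (2 : ℂ) • ∑ a, ∑ b, Klow a b • (JU a (-1) * JU b 0 * JU c 0)
    - t • ∑ a, ∑ b, fLow c a b • (JU a (-1) * JU b 0)
    - t ^ 2 • JU c (-1)

end

end AffineSl2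

/-! Everything reduces to polynomials in `J^0_0`. Modulo the left ideal, products can be reordered
so that negative modes stand to the left of zero modes; the Casimir relation turns `J^+_0 J^-_0` and
`J^-_0 J^+_0` into polynomials in `J^0_0`, and positive modes die on the right. Hence an element of
level one and charge zero has the form `J^0_{-1} p + J^+_{-1} J^-_0 p₁ + J^-_{-1} J^+_0 p₂` with `p,
p₁, p₂` polynomials in `J^0_0` (`levelOne`, `exists_levelOne_of_mem`). On such an element `J^+_1`
and `J^-_1` give `J^±_0` times a polynomial. If those polynomials must vanish, then `p = (2X + t) p₂
= (2X - t) p₁`, and since `t ≠ 0` the two linear factors are coprime: `p₁ = (2X + t) q` and `p₂ =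
(2X - t) q`, which is exactly `T̂⁰₁ q`. Conversely, for this shape `J^±_1` annihilate the element
identically, and `J^0_1` does so precisely by the value of `j (j + 1)`. The real difficulty is that
the quotient is not too small: a nonzero polynomial in `J^0_0` must have nonzero class
(`eq_zero_of_cls_aeval_eq_zero`). Instead of a PBW basis, a concrete module detects it. The affine
algebra acts by first order differential operators on functions on a group of loops `g(z)` with
`g(0)` upper unitriangular, a coinduced module of level `k` and weight `κ`. Right translation by `Y`
moves `g` by `(g Y g⁻¹) g`; the positive half of `g Y g⁻¹` is realised as a vector field, the
complementary half acts through the character `κ • diagZero`, and a residue term produces the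
central charge (`loopOp`, `loopOp_lie`). For `κ = j` the powers `xⁿ` of the unipotent coordinate are
killed by the whole left ideal and are eigenvectors of `J^0_0` with eigenvalues `j - n`, so a
polynomial with zero class has infinitely many roots. -/

namespace AffineSl2

noncomputable section

/-! ### Coefficientwise maps and products of Laurent series -/

section CoeffwiseMaps

variable {A : Type*} [Ring A]

/-- Apply an additive map to every coefficient of a Laurent series. -/
def mapCoeff (δ : ℤ → A →+ A) : HahnSeries ℤ A →+ HahnSeries ℤ A where
  toFun f := ⟨fun n => δ n (f.coeff n), f.isPWO_support.mono fun n hn h0 => hn (by simp [h0])⟩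
  map_zero' := by ext n; simp
  map_add' f g := by ext n; simp

@[simp]
lemma mapCoeff_coeff (δ : ℤ → A →+ A) (f : HahnSeries ℤ A) (n : ℤ) :
    (mapCoeff δ f).coeff n = δ n (f.coeff n) := rfl

lemma support_mapCoeff_subset (δ : ℤ → A →+ A) (f : HahnSeries ℤ A) :
    (mapCoeff δ f).support ⊆ f.support := fun n hn h0 => hn (by simp [h0])

/-- The maps may depend on the degree, so that one Leibniz rule serves both derivations of the
coefficients and `z d/dz`. -/
lemma mapCoeff_mul {δ : ℤ → A →+ A}
    (h : ∀ m n a b, δ (m + n) (a * b) = δ m a * b + a * δ n b) (f g : HahnSeries ℤ A) :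
    mapCoeff δ (f * g) = mapCoeff δ f * g + f * mapCoeff δ g := by
  ext n
  rw [mapCoeff_coeff, HahnSeries.coeff_add,
    HahnSeries.coeff_mul_left' f.isPWO_support (support_mapCoeff_subset δ f),
    HahnSeries.coeff_mul_right' g.isPWO_support (support_mapCoeff_subset δ g),
    HahnSeries.coeff_mul, map_sum, ← Finset.sum_add_distrib]
  refine Finset.sum_congr rfl fun ij hij => ?_
  obtain ⟨-, -, rfl⟩ := Finset.mem_antidiagonal.1 hij
  exact h _ _ _ _

lemma coeff_mul_eq_zero {f g : HahnSeries ℤ A} {n : ℤ}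
    (h : ∀ i j, i + j = n → f.coeff i * g.coeff j = 0) : (f * g).coeff n = 0 := by
  rw [HahnSeries.coeff_mul]
  refine Finset.sum_eq_zero fun ij hij => ?_
  obtain ⟨-, -, hn⟩ := Finset.mem_antidiagonal.1 hij
  exact h _ _ hn

lemma coeff_mul_eq_single {f g : HahnSeries ℤ A} {n : ℤ} (i₀ j₀ : ℤ) (h₀ : i₀ + j₀ = n)
    (h : ∀ i j, i + j = n → i ≠ i₀ → f.coeff i * g.coeff j = 0) :
    (f * g).coeff n = f.coeff i₀ * g.coeff j₀ := by
  rw [HahnSeries.coeff_mul]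
  refine Finset.sum_eq_single (i₀, j₀) ?_ ?_
  · rintro ⟨i, j⟩ hij hne
    obtain ⟨-, -, hn⟩ := Finset.mem_antidiagonal.1 hij
    simp only at hn
    refine h _ _ hn fun hi => hne ?_
    subst hi
    rw [show j = j₀ by omega]
  · intro hij
    by_contra hne
    exact hij (Finset.mem_antidiagonal.2
      ⟨fun h0 => hne (by rw [h0, zero_mul]), fun h0 => hne (by rw [h0, mul_zero]), h₀⟩)

end CoeffwiseMaps

/-! ### The generic loop and the projection to the positive half -/

/-- The coordinate ring of the group of loops `g(z) ∈ GL₂(ℂ[[z]])` for which `g(0)` is upper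
unitriangular: the variable `(n, i, j)` is the coefficient of `zⁿ` in the entry `(i, j)`. -/
abbrev CoordRing : Type := MvPolynomial (ℕ × Fin 2 × Fin 2) ℂ

/-- Two by two matrices over the coordinate ring. -/
abbrev Mat : Type := Matrix (Fin 2) (Fin 2) CoordRing

/-- Laurent series with matrix coefficients. -/
abbrev LoopMat : Type := HahnSeries ℤ Mat

lemma smul_mul_loop (c : ℂ) (f g : LoopMat) : (c • f) * g = c • (f * g) := by
  ext1
  funext n
  rw [HahnSeries.coeff_mul_left' f.isPWO_support (HahnSeries.support_smul_subset c f),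
    HahnSeries.coeff_smul, HahnSeries.coeff_mul, Finset.smul_sum]
  simp only [HahnSeries.coeff_smul, smul_mul_assoc]

lemma mul_smul_loop (c : ℂ) (f g : LoopMat) : f * (c • g) = c • (f * g) := by
  ext1
  funext n
  rw [HahnSeries.coeff_mul_right' g.isPWO_support (HahnSeries.support_smul_subset c g),
    HahnSeries.coeff_smul, HahnSeries.coeff_mul, Finset.smul_sum]
  simp only [HahnSeries.coeff_smul, mul_smul_comm]

/-- The strictly upper triangular part of a matrix. -/
def strictUpper : Mat →+ Mat where
  toFun A := !![0, A 0 1; 0, 0]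
  map_zero' := by ext i j; fin_cases i <;> fin_cases j <;> rfl
  map_add' A B := by ext i j; fin_cases i <;> fin_cases j <;> simp

/-- The projection onto the positive part: positive powers of `z`, together with the strictly upper
triangular part of the constant term. -/
def posPart : LoopMat →+ LoopMat :=
  mapCoeff fun n => if 0 < n then AddMonoidHom.id _ else if n = 0 then strictUpper else 0

lemma posPart_coeff_pos (f : LoopMat) {n : ℤ} (hn : 0 < n) :
    (posPart f).coeff n = f.coeff n := by
  simp [posPart, hn]

lemma posPart_coeff_zero (f : LoopMat) :
    (posPart f).coeff 0 = strictUpper (f.coeff 0) := by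
  simp [posPart]

lemma posPart_coeff_neg (f : LoopMat) {n : ℤ} (hn : n < 0) : (posPart f).coeff n = 0 := by
  simp [posPart, hn.ne, hn.not_gt]

lemma posPart_eq_self_iff {f : LoopMat} :
    posPart f = f ↔ (∀ n < 0, f.coeff n = 0) ∧ strictUpper (f.coeff 0) = f.coeff 0 := by
  constructor
  · intro h
    exact ⟨fun n hn => by rw [← h, posPart_coeff_neg f hn], by
      conv_rhs => rw [← h, posPart_coeff_zero]⟩
  · rintro ⟨h1, h2⟩
    ext1
    funext n
    rcases lt_trichotomy n 0 with hn | rfl | hn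
    · rw [posPart_coeff_neg f hn, h1 n hn]
    · rw [posPart_coeff_zero, h2]
    · rw [posPart_coeff_pos f hn]

lemma posPart_eq_zero_iff {f : LoopMat} :
    posPart f = 0 ↔ (∀ n > 0, f.coeff n = 0) ∧ strictUpper (f.coeff 0) = 0 := by
  constructor
  · intro h
    exact ⟨fun n hn => by rw [← posPart_coeff_pos f hn, h]; rfl, by
      rw [← posPart_coeff_zero, h]; rfl⟩
  · rintro ⟨h1, h2⟩
    ext1
    funext n
    rcases lt_trichotomy n 0 with hn | rfl | hn
    · rw [posPart_coeff_neg f hn]; rfl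
    · rw [posPart_coeff_zero, h2]; rfl
    · rw [posPart_coeff_pos f hn, h1 n hn]; rfl

lemma posPart_posPart (f : LoopMat) : posPart (posPart f) = posPart f := by
  rw [posPart_eq_self_iff]
  refine ⟨fun n hn => posPart_coeff_neg f hn, ?_⟩
  rw [posPart_coeff_zero]
  ext i j; fin_cases i <;> fin_cases j <;> rfl

/-- The generic loop. -/
def genericLoop : LoopMat :=
  HahnSeries.ofPowerSeries ℤ Mat (PowerSeries.mk fun n =>
    if n = 0 then !![1, MvPolynomial.X (0, 0, 1); 0, 1]
    else Matrix.of fun i j => MvPolynomial.X (n, i, j))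

/-- The inverse of the generic loop. -/
def genericLoopInv : LoopMat :=
  HahnSeries.ofPowerSeries ℤ Mat (PowerSeries.invOfUnit (PowerSeries.mk fun n =>
    if n = 0 then !![1, MvPolynomial.X (0, 0, 1); 0, 1]
    else Matrix.of fun i j => MvPolynomial.X (n, i, j))
    ⟨!![1, MvPolynomial.X (0, 0, 1); 0, 1], !![1, -MvPolynomial.X (0, 0, 1); 0, 1],
      by simp [Matrix.one_fin_two], by simp [Matrix.one_fin_two]⟩)

lemma genericLoop_mul_inv : genericLoop * genericLoopInv = 1 := by
  rw [genericLoop, genericLoopInv, ← map_mul, PowerSeries.mul_invOfUnit, map_one]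
  simp [← PowerSeries.coeff_zero_eq_constantCoeff_apply]

lemma genericLoop_inv_mul : genericLoopInv * genericLoop = 1 := by
  rw [genericLoop, genericLoopInv, ← map_mul, PowerSeries.invOfUnit_mul, map_one]
  simp [← PowerSeries.coeff_zero_eq_constantCoeff_apply]

lemma genericLoop_coeff_neg {n : ℤ} (hn : n < 0) : genericLoop.coeff n = 0 := by
  rw [genericLoop, PowerSeries.coeff_coe, if_pos hn]

lemma genericLoopInv_coeff_neg {n : ℤ} (hn : n < 0) : genericLoopInv.coeff n = 0 := by
  rw [genericLoopInv, PowerSeries.coeff_coe, if_pos hn]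

lemma genericLoop_coeff_zero :
    genericLoop.coeff 0 = !![1, MvPolynomial.X (0, 0, 1); 0, 1] := by
  rw [genericLoop, PowerSeries.coeff_coe]; simp

lemma genericLoop_coeff_pos {n : ℤ} (hn : 0 < n) :
    genericLoop.coeff n = Matrix.of fun i j => MvPolynomial.X (n.natAbs, i, j) := by
  rw [genericLoop, PowerSeries.coeff_coe, if_neg hn.not_gt, PowerSeries.coeff_mk, if_neg]
  omega

lemma genericLoopInv_coeff_zero :
    genericLoopInv.coeff 0 = !![1, -MvPolynomial.X (0, 0, 1); 0, 1] := by
  rw [genericLoopInv, PowerSeries.coeff_coe]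
  simp

/-! ### Vector fields on the loop group -/

/-- The right-invariant vector field with value `Z`. -/
def vectorField (Z : LoopMat) : Derivation ℂ CoordRing CoordRing :=
  MvPolynomial.mkDerivation ℂ fun v => (Z * genericLoop).coeff v.1 v.2.1 v.2.2

lemma vectorField_X (Z : LoopMat) (v : ℕ × Fin 2 × Fin 2) :
    vectorField Z (MvPolynomial.X v) = (Z * genericLoop).coeff v.1 v.2.1 v.2.2 :=
  MvPolynomial.mkDerivation_X _ _ _

lemma vectorField_add (Z Z' : LoopMat) : vectorField (Z + Z') = vectorField Z + vectorField Z' :=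
  MvPolynomial.derivation_ext fun v => by simp [vectorField_X, add_mul]

lemma vectorField_smul (c : ℂ) (Z : LoopMat) : vectorField (c • Z) = c • vectorField Z :=
  MvPolynomial.derivation_ext fun v => by simp [vectorField_X, smul_mul_loop]

/-- A derivation of the coordinate ring, applied entry by entry to a matrix. -/
def mapEntries (D : Derivation ℂ CoordRing CoordRing) : Mat →+ Mat where
  toFun A := A.map D
  map_zero' := by ext; simp
  map_add' A B := by ext; simp

lemma mapEntries_apply (D : Derivation ℂ CoordRing CoordRing) (A : Mat) (i k : Fin 2) :
    mapEntries D A i k = D (A i k) := rfl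

lemma mapEntries_mul (D : Derivation ℂ CoordRing CoordRing) (A B : Mat) :
    mapEntries D (A * B) = mapEntries D A * B + A * mapEntries D B := by
  refine Matrix.ext fun i k => ?_
  simp only [mapEntries_apply, Matrix.add_apply, Matrix.mul_apply, map_sum, Derivation.leibniz,
    smul_eq_mul, ← Finset.sum_add_distrib]
  exact Finset.sum_congr rfl fun l _ => by ring

/-- A derivation of the coordinate ring, applied to all coefficients. -/
def liftDer (D : Derivation ℂ CoordRing CoordRing) : LoopMat →+ LoopMat :=
  mapCoeff fun _ => mapEntries D

lemma liftDer_coeff (D : Derivation ℂ CoordRing CoordRing) (f : LoopMat) (n : ℤ) (i k : Fin 2) :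
    (liftDer D f).coeff n i k = D (f.coeff n i k) := rfl

lemma liftDer_mul (D : Derivation ℂ CoordRing CoordRing) (f g : LoopMat) :
    liftDer D (f * g) = liftDer D f * g + f * liftDer D g :=
  mapCoeff_mul (fun _ _ a b => mapEntries_mul D a b) f g

lemma liftDer_one (D : Derivation ℂ CoordRing CoordRing) : liftDer D 1 = 0 := by
  have h := liftDer_mul D 1 1
  simpa using h

lemma liftDer_posPart (D : Derivation ℂ CoordRing CoordRing) (f : LoopMat) :
    liftDer D (posPart f) = posPart (liftDer D f) := by
  ext n i j
  rw [liftDer_coeff]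
  rcases lt_trichotomy n 0 with hn | rfl | hn
  · rw [posPart_coeff_neg _ hn, posPart_coeff_neg _ hn]; simp
  · rw [posPart_coeff_zero, posPart_coeff_zero]
    fin_cases i <;> fin_cases j <;> simp [strictUpper, liftDer_coeff]
  · rw [posPart_coeff_pos _ hn, posPart_coeff_pos _ hn, liftDer_coeff]

/-! ### The Euler derivation, residues and the Cartan component -/

/-- The Euler derivation `z d/dz`. -/
def euler : LoopMat →+ LoopMat := mapCoeff fun n => zsmulAddGroupHom n

lemma euler_coeff (f : LoopMat) (n : ℤ) : (euler f).coeff n = n • f.coeff n := rfl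

lemma euler_mul (f g : LoopMat) : euler (f * g) = euler f * g + f * euler g :=
  mapCoeff_mul (fun m n a b => by
    simp only [zsmulAddGroupHom_apply, add_smul, smul_mul_assoc, mul_smul_comm]) f g

lemma euler_one : euler 1 = 0 := by
  have h := euler_mul 1 1
  simpa using h

lemma liftDer_euler (D : Derivation ℂ CoordRing CoordRing) (f : LoopMat) :
    liftDer D (euler f) = euler (liftDer D f) := by
  ext n i j
  simp [liftDer_coeff, euler_coeff]

/-- The trace of the constant term. -/
def trZero : LoopMat →+ CoordRing where
  toFun f := (f.coeff 0).trace
  map_zero' := by simp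
  map_add' f g := by simp

lemma trZero_apply (f : LoopMat) : trZero f = (f.coeff 0).trace := rfl

lemma trZero_mul_comm (f g : LoopMat) : trZero (f * g) = trZero (g * f) := by
  simp only [trZero_apply, HahnSeries.coeff_mul, Matrix.trace_sum]
  refine Finset.sum_equiv (Equiv.prodComm _ _) ?_ ?_
  · rintro ⟨i, j⟩
    simp only [Finset.mem_antidiagonal, Equiv.prodComm_apply, Prod.swap_prod_mk]
    rw [add_comm i j]
    tauto
  · rintro ⟨i, j⟩ -
    exact Matrix.trace_mul_comm _ _

lemma trZero_euler (f : LoopMat) : trZero (euler f) = 0 := by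
  simp [trZero_apply, euler_coeff]

lemma liftDer_trZero (D : Derivation ℂ CoordRing CoordRing) (f : LoopMat) :
    D (trZero f) = trZero (liftDer D f) := by
  simp [trZero_apply, Matrix.trace_fin_two, liftDer_coeff]

/-- The difference of the two diagonal entries of the constant term. -/
def diagZero : LoopMat →+ CoordRing where
  toFun f := f.coeff 0 0 0 - f.coeff 0 1 1
  map_zero' := by simp
  map_add' f g := by simp; ring

lemma diagZero_apply (f : LoopMat) : diagZero f = f.coeff 0 0 0 - f.coeff 0 1 1 := rfl

lemma liftDer_diagZero (D : Derivation ℂ CoordRing CoordRing) (f : LoopMat) :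
    D (diagZero f) = diagZero (liftDer D f) := by
  simp [diagZero_apply, liftDer_coeff]

/-! ### Noncommutative ring identities used below -/

section RingIdentities

variable {A : Type*} [Ring A]

lemma eq_neg_mul_mul_of_inverse {g h dg dh : A} (hg : g * h = 1) (h0 : dh * g + h * dg = 0) :
    dh = -(h * dg * h) := by
  have h1 : dh * (g * h) + h * dg * h = 0 := by
    rw [← mul_assoc, ← add_mul, h0, zero_mul]
  rwa [hg, mul_one, ← eq_neg_iff_add_eq_zero] at h1

lemma mul_mul_add_mul_neg (z g y h : A) :
    z * g * y * h + g * y * -(h * z) = z * (g * y * h) - g * y * h * z := by noncomm_ring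

lemma neg_mul_mul_add_mul (g h z d dz : A) :
    -(h * z) * d + h * (dz * g + z * d) = h * dz * g := by noncomm_ring

lemma conj_derivative (g h y dg dy : A) :
    (dg * y + g * dy) * h + g * y * -(h * dg * h) =
      dg * y * h - g * (y * (h * dg)) * h + g * dy * h := by noncomm_ring

lemma flow_commutator (z z' g a b : A) :
    a * g + z' * (z * g) - (b * g + z * (z' * g)) = (a - b + (z' * z - z * z')) * g := by
  noncomm_ring

/-- Here `p` and `q` play the positive parts of `a` and `b`: if `φ` kills the commutator of the
remainders, then `φ` of the full commutator is determined by terms involving `p` or `q`. -/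
lemma map_commutator_split {B : Type*} [AddCommGroup B] (φ : A →+ B) {a b p q : A}
    (h : φ ((a - p) * (b - q) - (b - q) * (a - p)) = 0) :
    φ (a * b - b * a) =
      φ (p * b - b * p) - φ (q * a - a * q) + (φ (q * p) - φ (p * q)) := by
  have h1 : (a - p) * (b - q) - (b - q) * (a - p) =
      (a * b - b * a) - ((p * b - b * p) - (q * a - a * q) + (q * p - p * q)) := by
    noncomm_ring
  rw [h1, map_sub φ (a * b - b * a), sub_eq_zero] at h
  rw [h, map_add, map_sub φ (p * b - b * p), map_sub φ (q * p)]

lemma mul_split (a b p q : A) : (a - p) * (b - q) = a * b - (p * b + a * q) + p * q := by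
  noncomm_ring

end RingIdentities

/-! ### Adjoint action, logarithmic derivative, and their variation along vector fields -/

/-- The adjoint action of the generic loop. -/
def conj (Y : LoopMat) : LoopMat := genericLoop * Y * genericLoopInv

lemma conj_add (Y W : LoopMat) : conj (Y + W) = conj Y + conj W := by
  simp only [conj, mul_add, add_mul]

lemma conj_sub (Y W : LoopMat) : conj (Y - W) = conj Y - conj W := by
  simp only [conj, mul_sub, sub_mul]

lemma conj_smul (c : ℂ) (Y : LoopMat) : conj (c • Y) = c • conj Y := by
  simp only [conj, smul_mul_loop, mul_smul_loop]

lemma conj_mul (Y W : LoopMat) : conj (Y * W) = conj Y * conj W := by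
  have h : conj Y * conj W =
      genericLoop * Y * (genericLoopInv * genericLoop) * W * genericLoopInv := by
    simp only [conj, mul_assoc]
  rw [h, genericLoop_inv_mul, mul_one, conj, mul_assoc genericLoop Y W]

/-- The logarithmic derivative of the generic loop. -/
def maurerCartan : LoopMat := genericLoopInv * euler genericLoop

lemma euler_genericLoopInv :
    euler genericLoopInv = -(genericLoopInv * euler genericLoop * genericLoopInv) := by
  refine eq_neg_mul_mul_of_inverse genericLoop_mul_inv ?_
  rw [← euler_mul, genericLoop_inv_mul, euler_one]

/-- This is the equation `δg = Z g` that `vectorField` is built to satisfy. In degree zero only the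
entry `(0, 1)` of `g` is a coordinate, the others being constants, so `Z` has to be strictly upper
triangular there for both sides to agree. -/
lemma liftDer_genericLoop {Z : LoopMat} (hZ : posPart Z = Z) :
    liftDer (vectorField Z) genericLoop = Z * genericLoop := by
  obtain ⟨h1, h2⟩ := posPart_eq_self_iff.1 hZ
  refine HahnSeries.ext (funext fun n => Matrix.ext fun i j => ?_)
  rw [liftDer_coeff]
  rcases lt_trichotomy n 0 with hn | rfl | hn
  · rw [genericLoop_coeff_neg hn, coeff_mul_eq_zero]
    · simp
    · intro a b hab
      rcases lt_or_ge a 0 with ha | ha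
      · rw [h1 a ha, zero_mul]
      · rw [genericLoop_coeff_neg (by omega), mul_zero]
  · have h0 : (Z * genericLoop).coeff 0 = Z.coeff 0 * genericLoop.coeff 0 := by
      refine coeff_mul_eq_single 0 0 (add_zero 0) fun a b hab ha => ?_
      rcases lt_or_gt_of_ne ha with ha | ha
      · rw [h1 a ha, zero_mul]
      · rw [genericLoop_coeff_neg (by omega), mul_zero]
    have hX : vectorField Z (MvPolynomial.X (0, 0, 1)) = (Z * genericLoop).coeff 0 0 1 :=
      vectorField_X _ _
    rw [h0, ← h2, genericLoop_coeff_zero] at *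
    fin_cases i <;> fin_cases j <;> simp [strictUpper, Matrix.mul_apply] at hX ⊢
    exact hX
  · rw [genericLoop_coeff_pos hn, Matrix.of_apply, vectorField_X]
    simp only [Int.natCast_natAbs, abs_of_pos hn]

lemma liftDer_genericLoopInv {Z : LoopMat} (hZ : posPart Z = Z) :
    liftDer (vectorField Z) genericLoopInv = -(genericLoopInv * Z) := by
  have h : liftDer (vectorField Z) genericLoopInv =
      -(genericLoopInv * (Z * genericLoop) * genericLoopInv) := by
    refine eq_neg_mul_mul_of_inverse genericLoop_mul_inv ?_
    rw [← liftDer_genericLoop hZ, ← liftDer_mul, genericLoop_inv_mul, liftDer_one]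
  rw [h, mul_assoc, mul_assoc Z, genericLoop_mul_inv, mul_one]

/-- A Laurent series whose coefficients are constant on the group of loops. -/
def IsConst (Y : LoopMat) : Prop := ∀ D : Derivation ℂ CoordRing CoordRing, liftDer D Y = 0

/-- From `δg = Z g` and `δ(g⁻¹) = -g⁻¹ Z`, conjugates of constants vary by the commutator with `Z`.
-/
lemma liftDer_conj {Z Y : LoopMat} (hZ : posPart Z = Z) (hY : IsConst Y) :
    liftDer (vectorField Z) (conj Y) = Z * conj Y - conj Y * Z := by
  rw [conj, liftDer_mul, liftDer_mul, hY, mul_zero, add_zero, liftDer_genericLoop hZ,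
    liftDer_genericLoopInv hZ]
  exact mul_mul_add_mul_neg _ _ _ _

/-- In the variation of `g⁻¹ (z g')` the undifferentiated `Z` terms cancel, leaving only the
derivative of `Z`; this is how the level cocycle arises. -/
lemma liftDer_maurerCartan {Z : LoopMat} (hZ : posPart Z = Z) :
    liftDer (vectorField Z) maurerCartan = genericLoopInv * euler Z * genericLoop := by
  rw [maurerCartan, liftDer_mul, liftDer_euler, liftDer_genericLoop hZ,
    liftDer_genericLoopInv hZ, euler_mul]
  exact neg_mul_mul_add_mul _ _ _ _ _

lemma euler_conj (Y : LoopMat) : euler (conj Y) =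
    conj (maurerCartan * Y - Y * maurerCartan + euler Y) := by
  have h : conj (maurerCartan * Y) = euler genericLoop * Y * genericLoopInv := by
    rw [conj, maurerCartan]
    simp only [← mul_assoc]
    rw [genericLoop_mul_inv, one_mul]
  rw [conj_add, conj_sub, h, conj, euler_mul, euler_mul, euler_genericLoopInv, conj, conj]
  exact conj_derivative _ _ _ _ _

lemma trZero_conj (Y : LoopMat) : trZero (conj Y) = trZero Y := by
  rw [conj, trZero_mul_comm, ← mul_assoc, genericLoop_inv_mul, one_mul]

/-- Since `Z` and `Z'` are functions on the group, the bracket contains their mutual derivatives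
besides the reversed commutator expected of right-invariant fields. -/
lemma vectorField_lie {Z Z' : LoopMat} (hZ : posPart Z = Z) (hZ' : posPart Z' = Z') :
    ⁅vectorField Z, vectorField Z'⁆ = vectorField (liftDer (vectorField Z) Z' -
      liftDer (vectorField Z') Z + (Z' * Z - Z * Z')) := by
  refine MvPolynomial.derivation_ext fun v => ?_
  have h : ∀ (D : Derivation ℂ CoordRing CoordRing) (W : LoopMat),
      D (vectorField W (MvPolynomial.X v)) =
        (liftDer D (W * genericLoop)).coeff v.1 v.2.1 v.2.2 := fun D W => by
    rw [vectorField_X, liftDer_coeff]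
  rw [Derivation.commutator_apply, h, h, liftDer_mul, liftDer_mul, liftDer_genericLoop hZ,
    liftDer_genericLoop hZ', vectorField_X, ← Matrix.sub_apply, ← HahnSeries.coeff_sub]
  rw [flow_commutator]

/-! ### The two complementary subalgebras of the loop algebra -/

lemma posPart_mul {p q : LoopMat} (hp : posPart p = p) (hq : posPart q = q) :
    posPart (p * q) = p * q ∧ diagZero (p * q) = 0 := by
  obtain ⟨p1, p2⟩ := posPart_eq_self_iff.1 hp
  obtain ⟨q1, q2⟩ := posPart_eq_self_iff.1 hq
  have h0 : (p * q).coeff 0 = 0 := by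
    rw [coeff_mul_eq_single 0 0 (add_zero 0), ← p2, ← q2]
    · ext i j
      fin_cases i <;> fin_cases j <;> simp [strictUpper]
    · intro a b hab ha
      rcases lt_or_gt_of_ne ha with ha | ha
      · rw [p1 a ha, zero_mul]
      · rw [q1 b (by omega), mul_zero]
  refine ⟨posPart_eq_self_iff.2 ⟨fun n hn => coeff_mul_eq_zero fun a b hab => ?_, ?_⟩, ?_⟩
  · rcases lt_or_ge a 0 with ha | ha
    · rw [p1 a ha, zero_mul]
    · rw [q1 b (by omega), mul_zero]
  · rw [h0, map_zero]
  · rw [diagZero_apply, h0]; simp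

/-- The kernel of `posPart` consists of negative powers with a lower triangular constant term. It is
closed under products, and in a commutator the diagonals of the constant terms cancel, so `diagZero`
is a character of this half. -/
lemma posPart_commutator {m n : LoopMat} (hm : posPart m = 0) (hn : posPart n = 0) :
    posPart (m * n - n * m) = 0 ∧ diagZero (m * n - n * m) = 0 := by
  obtain ⟨m1, m2⟩ := posPart_eq_zero_iff.1 hm
  obtain ⟨n1, n2⟩ := posPart_eq_zero_iff.1 hn
  have key : ∀ {p q : LoopMat}, (∀ n > 0, p.coeff n = 0) → (∀ n > 0, q.coeff n = 0) →
      (p * q).coeff 0 = p.coeff 0 * q.coeff 0 ∧ ∀ n > 0, (p * q).coeff n = 0 := by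
    intro p q hp hq
    refine ⟨coeff_mul_eq_single 0 0 (add_zero 0) fun a b hab ha => ?_,
      fun n hn => coeff_mul_eq_zero fun a b hab => ?_⟩
    · rcases lt_or_gt_of_ne ha with ha | ha
      · rw [hq b (by omega), mul_zero]
      · rw [hp a ha, zero_mul]
    · rcases lt_or_ge 0 a with ha | ha
      · rw [hp a ha, zero_mul]
      · rw [hq b (by omega), mul_zero]
  obtain ⟨e1, f1⟩ := key m1 n1
  obtain ⟨e2, f2⟩ := key n1 m1
  have hm01 : m.coeff 0 0 1 = 0 := congrFun (congrFun m2 0) 1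
  have hn01 : n.coeff 0 0 1 = 0 := congrFun (congrFun n2 0) 1
  refine ⟨posPart_eq_zero_iff.2 ⟨fun i hi => ?_, ?_⟩, ?_⟩
  · rw [HahnSeries.coeff_sub, f1 i hi, f2 i hi, sub_zero]
  · rw [HahnSeries.coeff_sub, e1, e2]
    ext1 i j
    fin_cases i <;> fin_cases j <;> simp [strictUpper, Matrix.mul_apply, hm01, hn01]
  · rw [diagZero_apply, HahnSeries.coeff_sub, e1, e2]
    simp [Matrix.mul_apply, hm01, hn01]
    ring

lemma trZero_euler_mul_of_posPart_eq_self {p q : LoopMat} (hp : posPart p = p)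
    (hq : posPart q = q) : trZero (euler p * q) = 0 := by
  obtain ⟨p1, p2⟩ := posPart_eq_self_iff.1 hp
  obtain ⟨q1, q2⟩ := posPart_eq_self_iff.1 hq
  rw [trZero_apply, coeff_mul_eq_zero]
  · simp
  · intro a b hab
    rcases lt_trichotomy a 0 with ha | rfl | ha
    · rw [euler_coeff, p1 a ha, smul_zero, zero_mul]
    · rw [euler_coeff, zero_smul, zero_mul]
    · rw [q1 b (by omega), mul_zero]

lemma trZero_euler_mul_of_posPart_eq_zero {p q : LoopMat} (hp : posPart p = 0)
    (hq : posPart q = 0) : trZero (euler p * q) = 0 := by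
  obtain ⟨p1, p2⟩ := posPart_eq_zero_iff.1 hp
  obtain ⟨q1, q2⟩ := posPart_eq_zero_iff.1 hq
  rw [trZero_apply, coeff_mul_eq_zero]
  · simp
  · intro a b hab
    rcases lt_trichotomy a 0 with ha | rfl | ha
    · rw [q1 b (by omega), mul_zero]
    · rw [euler_coeff, zero_smul, zero_mul]
    · rw [euler_coeff, p1 a ha, smul_zero, zero_mul]

lemma trZero_euler_mul_antisymm (f g : LoopMat) :
    trZero (euler f * g) = -trZero (euler g * f) := by
  rw [eq_neg_iff_add_eq_zero, trZero_mul_comm (euler g), ← map_add, ← euler_mul, trZero_euler]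

lemma posPart_sub_posPart (a : LoopMat) : posPart (a - posPart a) = 0 := by
  rw [map_sub, posPart_posPart, sub_self]

/-- Both halves are subalgebras, so the commutator of the two remainders has no positive part;
expanding it gives the formula. It matches the bracket in `vectorField_lie`, which makes the vector
fields of positive parts a representation. -/
lemma posPart_lie (a b : LoopMat) :
    posPart (a * b - b * a) = posPart (posPart a * b - b * posPart a) -
      posPart (posPart b * a - a * posPart b) + (posPart b * posPart a - posPart a * posPart b) := by
  have h1 := (posPart_commutator (posPart_sub_posPart a) (posPart_sub_posPart b)).1
  have h2 := (posPart_mul (posPart_posPart a) (posPart_posPart b)).1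
  have h3 := (posPart_mul (posPart_posPart b) (posPart_posPart a)).1
  rw [map_commutator_split posPart h1, h2, h3]

lemma diagZero_lie (a b : LoopMat) :
    diagZero (a * b - b * a) = diagZero (posPart a * b - b * posPart a) -
      diagZero (posPart b * a - a * posPart b) := by
  have h1 := (posPart_commutator (posPart_sub_posPart a) (posPart_sub_posPart b)).2
  have h2 := (posPart_mul (posPart_posPart a) (posPart_posPart b)).2
  have h3 := (posPart_mul (posPart_posPart b) (posPart_posPart a)).2
  rw [map_commutator_split diagZero h1, h2, h3, sub_zero, add_zero]

/-- The cocycle `tr Res` vanishes on each half for reasons of degree, so only the mixed pairings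
survive, and antisymmetry of the cocycle brings them into this form. -/
lemma trZero_euler_posPart (a b : LoopMat) :
    trZero (euler (posPart a) * b) - trZero (euler (posPart b) * a) = trZero (euler a * b) := by
  have h1 := trZero_euler_mul_of_posPart_eq_self (posPart_posPart a) (posPart_posPart b)
  have h2 := trZero_euler_mul_of_posPart_eq_zero (posPart_sub_posPart a) (posPart_sub_posPart b)
  rw [trZero_euler_mul_antisymm (posPart b) a, sub_neg_eq_add]
  rw [map_sub, mul_split, map_add, h1, add_zero, map_sub, map_add, sub_eq_zero] at h2
  exact h2.symm

/-! ### The operators attached to loops and their commutators -/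

/-- The action of a loop on functions on the loop group, twisted by the level `k` and by the
weight `κ` of the Borel subalgebra. -/
def loopOp (k κ : ℂ) (Y : LoopMat) : Module.End ℂ CoordRing :=
  (vectorField (posPart (conj Y))).toLinearMap +
    LinearMap.mulLeft ℂ (κ • diagZero (conj Y) + k • trZero (maurerCartan * Y))

lemma loopOp_apply (k κ : ℂ) (Y : LoopMat) (r : CoordRing) :
    loopOp k κ Y r = vectorField (posPart (conj Y)) r +
      (κ • diagZero (conj Y) + k • trZero (maurerCartan * Y)) * r := rfl

lemma loopOp_add (k κ : ℂ) (Y W : LoopMat) :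
    loopOp k κ (Y + W) = loopOp k κ Y + loopOp k κ W := by
  refine LinearMap.ext fun r => ?_
  simp only [loopOp_apply, LinearMap.add_apply, conj_add, map_add, vectorField_add, mul_add,
    Derivation.add_apply, smul_add]
  ring

lemma posPart_smul (c : ℂ) (f : LoopMat) : posPart (c • f) = c • posPart f := by
  ext1
  funext n
  rw [HahnSeries.coeff_smul]
  rcases lt_trichotomy n 0 with hn | rfl | hn
  · rw [posPart_coeff_neg _ hn, posPart_coeff_neg _ hn, smul_zero]
  · rw [posPart_coeff_zero, posPart_coeff_zero]
    ext1 i j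
    fin_cases i <;> fin_cases j <;> simp [strictUpper]
  · rw [posPart_coeff_pos _ hn, posPart_coeff_pos _ hn, HahnSeries.coeff_smul]

lemma loopOp_smul (k κ c : ℂ) (Y : LoopMat) : loopOp k κ (c • Y) = c • loopOp k κ Y := by
  refine LinearMap.ext fun r => ?_
  have h1 : ∀ f : LoopMat, diagZero (c • f) = c • diagZero f := fun f => by
    simp [diagZero_apply, smul_sub]
  have h2 : ∀ f : LoopMat, trZero (c • f) = c • trZero f := fun f => by
    simp [trZero_apply, Matrix.trace_smul]
  simp only [loopOp_apply, LinearMap.smul_apply, conj_smul, posPart_smul, vectorField_smul,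
    Derivation.smul_apply, mul_smul_loop, h1, h2, smul_add, add_mul, smul_mul_assoc,
    smul_comm c κ, smul_comm c k]

/-- The vector field part closes by `posPart_lie`, the weight term by `diagZero_lie`, and the level
term fails to close by exactly the affine cocycle. -/
lemma loopOp_lie (k κ : ℂ) {Y W : LoopMat} (hY : IsConst Y) (hW : IsConst W) :
    loopOp k κ Y * loopOp k κ W - loopOp k κ W * loopOp k κ Y =
      loopOp k κ (Y * W - W * Y) + LinearMap.mulLeft ℂ (k • trZero (euler Y * W)) := by
  have hpY := posPart_posPart (conj Y)
  have hpW := posPart_posPart (conj W)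
  have hmc : ∀ {Z V : LoopMat}, posPart Z = Z → IsConst V →
      vectorField Z (trZero (maurerCartan * V)) = trZero (euler Z * conj V) := by
    intro Z V hZ hV
    rw [liftDer_trZero, liftDer_mul, hV, mul_zero, add_zero, liftDer_maurerCartan hZ, conj,
      mul_assoc, mul_assoc, trZero_mul_comm, mul_assoc]
  have hvf := vectorField_lie hpY hpW
  rw [liftDer_posPart, liftDer_posPart, liftDer_conj hpY hW, liftDer_conj hpW hY,
    ← posPart_lie, ← conj_mul, ← conj_mul, ← conj_sub] at hvf
  have hdiag := diagZero_lie (conj Y) (conj W)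
  rw [← liftDer_conj hpY hW, ← liftDer_conj hpW hY, ← liftDer_diagZero, ← liftDer_diagZero,
    ← conj_mul, ← conj_mul, ← conj_sub] at hdiag
  have htr := trZero_euler_posPart (conj Y) (conj W)
  rw [← hmc hpY hW, ← hmc hpW hY, euler_conj, ← conj_mul, trZero_conj] at htr
  -- Cyclicity of the trace absorbs the commutator with the logarithmic derivative into the level
  -- term of `[Y, W]`, leaving the cocycle as the remainder.
  have htr2 : trZero ((maurerCartan * Y - Y * maurerCartan + euler Y) * W) =
      trZero (maurerCartan * (Y * W - W * Y)) + trZero (euler Y * W) := by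
    have h := trZero_mul_comm Y (maurerCartan * W)
    simp only [add_mul, sub_mul, mul_sub, map_add, map_sub, mul_assoc] at h ⊢
    rw [h]
  rw [htr2] at htr
  refine LinearMap.ext fun r => ?_
  have hvr := congrArg (fun D => D r) hvf
  simp only [Derivation.commutator_apply] at hvr
  simp only [LinearMap.sub_apply, Module.End.mul_apply, LinearMap.add_apply, loopOp_apply,
    LinearMap.mulLeft_apply, ← hvr, hdiag, map_add, Derivation.leibniz,
    smul_eq_mul, MvPolynomial.smul_eq_C_mul, Derivation.leibniz, MvPolynomial.derivation_C]
  -- The vector field and weight contributions have been substituted already, so only the `k`-linear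
  -- identity is still needed.
  linear_combination (MvPolynomial.C k * r) * htr

/-! ### Modes, and the resulting representation of the affine algebra -/

/-- A mode of the loop algebra as a constant Laurent series. -/
def constLoop (n : ℤ) : Sl2 →ₗ[ℂ] LoopMat where
  toFun Y := HahnSeries.single n (Y.1.map (algebraMap ℂ CoordRing))
  map_add' Y W := by
    rw [← HahnSeries.single_add]
    congr 1
    ext1 i j
    simp
  map_smul' c Y := by
    refine HahnSeries.ext (funext fun m => Matrix.ext fun i j => ?_)
    by_cases h : m = n
    · subst h; simp [MvPolynomial.smul_eq_C_mul]
    · simp [HahnSeries.coeff_single_of_ne h]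

lemma constLoop_apply (n : ℤ) (Y : Sl2) :
    constLoop n Y = HahnSeries.single n (Y.1.map (algebraMap ℂ CoordRing)) := rfl

lemma isConst_constLoop (n : ℤ) (Y : Sl2) : IsConst (constLoop n Y) := by
  intro D
  refine HahnSeries.ext (funext fun m => Matrix.ext fun i j => ?_)
  rw [liftDer_coeff, constLoop_apply]
  by_cases h : m = n
  · subst h; simp
  · rw [HahnSeries.coeff_single_of_ne h]; simp

lemma constLoop_mul (n m : ℤ) (Y W : Sl2) : constLoop n Y * constLoop m W =
    HahnSeries.single (n + m) ((Y.1 * W.1).map (algebraMap ℂ CoordRing)) := by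
  rw [constLoop_apply, constLoop_apply, HahnSeries.single_mul_single, Matrix.map_mul]

lemma constLoop_lie (n m : ℤ) (Y W : Sl2) :
    constLoop n Y * constLoop m W - constLoop m W * constLoop n Y = constLoop (n + m) ⁅Y, W⁆ := by
  rw [constLoop_mul, constLoop_mul, add_comm m n, ← HahnSeries.single_sub, constLoop_apply]
  congr 1
  refine Matrix.ext fun i j => ?_
  simp [Ring.lie_def, -Matrix.map_mul]

lemma trZero_euler_constLoop (n m : ℤ) (Y W : Sl2) :
    trZero (euler (constLoop n Y) * constLoop m W) =
      algebraMap ℂ CoordRing (if n + m = 0 then (n : ℂ) * form Y W else 0) := by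
  have h : euler (constLoop n Y) = n • constLoop n Y := by
    refine HahnSeries.ext (funext fun i => ?_)
    rw [euler_coeff, HahnSeries.coeff_smul, constLoop_apply]
    by_cases hi : i = n
    · rw [hi]
    · rw [HahnSeries.coeff_single_of_ne hi, smul_zero, smul_zero]
  rw [h, smul_mul_assoc, constLoop_mul, map_zsmul, trZero_apply]
  split_ifs with h0
  · rw [h0, HahnSeries.coeff_single_same]
    simp [form_apply, Matrix.trace_fin_two, -Matrix.map_mul, mul_add]
  · rw [HahnSeries.coeff_single_of_ne (Ne.symm h0)]
    simp

/-- The representation of the affine Lie algebra by first order differential operators on the loop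
group. -/
def affineOp (k κ : ℂ) : Affine →ₗ[ℂ] Module.End ℂ CoordRing where
  toFun y := (LieAlgebra.LoopAlgebra.toFinsupp ℂ ℤ Sl2
        ((LieAlgebra.ofProd cocycle).symm y).1).sum (fun n Y => loopOp k κ (constLoop n Y)) +
      (k * TrivialLieModule.equiv ℂ (LieAlgebra.loopAlgebra ℂ ℤ Sl2) ℂ
        ((LieAlgebra.ofProd cocycle).symm y).2) • 1
  map_add' y z := by
    rw [LieAlgebra.of_symm_add, Prod.fst_add, Prod.snd_add, map_add, map_add,
      Finsupp.sum_add_index', mul_add, add_smul]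
    · abel
    · intro n; simpa using loopOp_smul k κ 0 0
    · intro n Y W; rw [map_add, loopOp_add]
  map_smul' c y := by
    rw [LieAlgebra.of_symm_smul, Prod.smul_fst, Prod.smul_snd, map_smul, map_smul,
      Finsupp.sum_smul_index', RingHom.id_apply, smul_add, Finsupp.smul_sum]
    · congr 1
      · simp only [map_smul, loopOp_smul]
      · rw [smul_smul, smul_eq_mul, mul_left_comm]
    · intro n; simpa using loopOp_smul k κ 0 0

lemma affineOp_J (k κ : ℂ) (a : Idx) (n : ℤ) :
    affineOp k κ (J a n) = loopOp k κ (constLoop n (gen a)) := by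
  have h0 : loopOp k κ 0 = 0 := by simpa using loopOp_smul k κ 0 0
  change (LieAlgebra.LoopAlgebra.toFinsupp ℂ ℤ Sl2
    (AddMonoidAlgebra.single n 1 ⊗ₜ[ℂ] gen a)).sum _ + (k * 0) • (1 : Module.End ℂ CoordRing) = _
  rw [LieAlgebra.LoopAlgebra.toFinsupp_single_tmul, Finsupp.sum_single_index]
  · simp
  · rw [map_zero, h0]

lemma affineOp_central (k κ : ℂ) : affineOp k κ central = k • 1 := by
  change (LieAlgebra.LoopAlgebra.toFinsupp ℂ ℤ Sl2 0).sum _ + (k * 1) • (1 : Module.End ℂ CoordRing) = _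
  simp

lemma gen_span (Y : Sl2) : ∃ c : Idx → ℂ, Y = ∑ a, c a • gen a := by
  have h : Y.1 1 1 = -Y.1 0 0 := by
    have h2 : Matrix.trace Y.1 = 0 := by simpa [LieAlgebra.SpecialLinear.sl] using Y.2
    rw [Matrix.trace_fin_two] at h2
    linear_combination h2
  refine ⟨fun a => match a with
    -- The factor two compensates `t⁰ = diag(1/2, -1/2)`.
    | .zero => 2 * Y.1 0 0
    | .plus => Y.1 0 1
    | .minus => Y.1 1 0, ?_⟩
  rw [sum_idx]
  apply Subtype.ext
  ext i j
  fin_cases i <;> fin_cases j <;> simp [gen, h]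
  all_goals ring

lemma affine_span :
    Submodule.span ℂ (insert central {x | ∃ a n, x = J a n}) = (⊤ : Submodule ℂ Affine) := by
  rw [eq_top_iff]
  intro y _
  have hJ : ∀ a n, J a n ∈ Submodule.span ℂ (insert central {x | ∃ a n, x = J a n}) :=
    fun a n => Submodule.subset_span (Or.inr ⟨a, n, rfl⟩)
  have h1 : ∀ x : LieAlgebra.loopAlgebra ℂ ℤ Sl2, LieAlgebra.ofProd cocycle (x, 0) ∈
      Submodule.span ℂ (insert central {x | ∃ a n, x = J a n}) := by
    let incl : LieAlgebra.loopAlgebra ℂ ℤ Sl2 →ₗ[ℂ] Affine :=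
      { toFun := fun x => LieAlgebra.ofProd cocycle (x, 0)
        map_add' := fun x y => by rw [← LieAlgebra.of_add, Prod.mk_add_mk, add_zero]
        map_smul' := fun c x => by
          rw [RingHom.id_apply, ← LieAlgebra.of_smul, Prod.smul_mk, smul_zero] }
    let S := (Submodule.span ℂ (insert central {x | ∃ a n, x = J a n})).comap incl
    have hS : ∀ (n : ℤ) (a : Idx), AddMonoidAlgebra.single n (1 : ℂ) ⊗ₜ[ℂ] gen a ∈ S :=
      fun n a => hJ a n
    intro x
    change x ∈ S
    induction x using TensorProduct.induction_on with
    | zero => exact S.zero_mem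
    | add x y hx hy => exact S.add_mem hx hy
    | tmul f Y =>
      obtain ⟨c, rfl⟩ := gen_span Y
      rw [TensorProduct.tmul_sum]
      refine S.sum_mem fun a _ => ?_
      rw [TensorProduct.tmul_smul]
      refine S.smul_mem _ ?_
      induction f using AddMonoidAlgebra.induction_linear with
      | zero => rw [TensorProduct.zero_tmul]; exact S.zero_mem
      | add f g hf hg => rw [TensorProduct.add_tmul]; exact S.add_mem hf hg
      | single n b =>
        have : AddMonoidAlgebra.single n b = b • AddMonoidAlgebra.single n (1 : ℂ) := by
          rw [AddMonoidAlgebra.smul_single, smul_eq_mul, mul_one]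
        rw [this, ← TensorProduct.smul_tmul']
        exact S.smul_mem _ (hS n a)
  have h2 : y = LieAlgebra.ofProd cocycle (((LieAlgebra.ofProd cocycle).symm y).1, 0) +
      (TrivialLieModule.equiv ℂ (LieAlgebra.loopAlgebra ℂ ℤ Sl2) ℂ
        ((LieAlgebra.ofProd cocycle).symm y).2) • central := by
    apply (LieAlgebra.ofProd cocycle).symm.injective
    rw [central, ← LieAlgebra.of_smul, ← LieAlgebra.of_add, Equiv.symm_apply_apply]
    refine Prod.ext ?_ ?_
    · simp
    · simp only [Prod.smul_mk, Prod.mk_add_mk, zero_add, ← map_smul, smul_eq_mul, mul_one]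
      exact ((TrivialLieModule.equiv ℂ _ ℂ).symm_apply_apply _).symm
  rw [h2]
  exact Submodule.add_mem _ (h1 _) (Submodule.smul_mem _ _ (Submodule.subset_span (Or.inl rfl)))

lemma central_lie_J (a : Idx) (n : ℤ) : ⁅central, J a n⁆ = 0 := by
  have h3 : ⁅central, J a n⁆ = LieAlgebra.ofProd cocycle
      (⁅((0 : AddMonoidAlgebra ℂ ℤ) ⊗ₜ[ℂ] (0 : Sl2) : LieAlgebra.loopAlgebra ℂ ℤ Sl2),
        (AddMonoidAlgebra.single n (1 : ℂ) ⊗ₜ[ℂ] gen a : LieAlgebra.loopAlgebra ℂ ℤ Sl2)⁆,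
      (TrivialLieModule.equiv ℂ _ ℂ).symm (LieAlgebra.LoopAlgebra.residuePairing ℂ ℤ Sl2 (-form)
      0 (AddMonoidAlgebra.single n (1 : ℂ) ⊗ₜ[ℂ] gen a)) + 0 - 0) := by
    rw [TensorProduct.zero_tmul]
    rfl
  rw [h3, LieAlgebra.ExtendScalars.bracket_tmul, zero_mul, TensorProduct.zero_tmul, map_zero,
    LinearMap.zero_apply, map_zero, add_zero, sub_zero]
  rfl

lemma central_lie (x : Affine) : ⁅central, x⁆ = 0 := by
  have hx : x ∈ Submodule.span ℂ (insert central {x | ∃ a n, x = J a n}) := by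
    rw [affine_span]; trivial
  induction hx using Submodule.span_induction with
  | zero => exact lie_zero _
  | add x y _ _ hx hy => rw [lie_add, hx, hy, add_zero]
  | smul c x _ hx => rw [lie_smul, hx, smul_zero]
  | mem x hx =>
    rcases hx with rfl | ⟨a, n, rfl⟩
    · exact lie_self _
    · exact central_lie_J a n

/-- Both sides are bilinear, so it is enough to compare them on the modes, where `loopOp_lie`
applies, and on the central element. -/
lemma affineOp_lie (k κ : ℂ) (x y : Affine) : affineOp k κ ⁅x, y⁆ =
    affineOp k κ x * affineOp k κ y - affineOp k κ y * affineOp k κ x := by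
  have hcen : ∀ y : Affine, affineOp k κ ⁅central, y⁆ =
      affineOp k κ central * affineOp k κ y - affineOp k κ y * affineOp k κ central := by
    intro y
    rw [central_lie, map_zero, affineOp_central, smul_mul_assoc, mul_smul_comm, one_mul, mul_one,
      sub_self]
  have hx : x ∈ Submodule.span ℂ (insert central {x | ∃ a n, x = J a n}) := by
    rw [affine_span]; trivial
  have hy : y ∈ Submodule.span ℂ (insert central {x | ∃ a n, x = J a n}) := by
    rw [affine_span]; trivial
  induction hx using Submodule.span_induction with
  | zero => simp
  | add x x' _ _ h h' => rw [add_lie, map_add, h, h', map_add, add_mul, mul_add]; abel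
  | smul c x _ h =>
    rw [smul_lie, map_smul, h, map_smul, smul_mul_assoc, mul_smul_comm, smul_sub]
  | mem x hx =>
    rcases hx with rfl | ⟨a, n, rfl⟩
    · exact hcen y
    induction hy using Submodule.span_induction with
    | zero => simp
    | add x x' _ _ h h' => rw [lie_add, map_add, h, h', map_add, add_mul, mul_add]; abel
    | smul c x _ h =>
      rw [lie_smul, map_smul, h, map_smul, smul_mul_assoc, mul_smul_comm, smul_sub]
    | mem y hy =>
      rcases hy with rfl | ⟨b, m, rfl⟩
      · rw [← lie_skew, map_neg, hcen, neg_sub]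
      · rw [affineOp_J, affineOp_J, loopOp_lie k κ (isConst_constLoop _ _) (isConst_constLoop _ _),
          J_lie, constLoop_lie, trZero_euler_constLoop, gen_lie, map_add, map_smul,
          affineOp_central, sum_idx, sum_idx]
        simp only [map_add, map_smul, loopOp_add, loopOp_smul, affineOp_J, Kup]
        congr 1
        refine LinearMap.ext fun r => ?_
        simp only [LinearMap.mulLeft_apply, LinearMap.smul_apply, Module.End.one_apply,
          MvPolynomial.smul_eq_C_mul, MvPolynomial.algebraMap_eq]
        ring

/-- The action of the universal enveloping algebra on functions on the loop group. -/
def rep (k κ : ℂ) : U →ₐ[ℂ] Module.End ℂ CoordRing :=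
  letI : LieRing (Module.End ℂ CoordRing) := LieRing.ofAssociativeRing
  UniversalEnvelopingAlgebra.lift ℂ
    { toLinearMap := affineOp k κ
      map_lie' := fun {x y} => by
        rw [LieRing.of_associative_ring_bracket]
        exact affineOp_lie k κ x y }

lemma rep_JU (k κ : ℂ) (a : Idx) (n : ℤ) :
    rep k κ (JU a n) = loopOp k κ (constLoop n (gen a)) := by
  rw [← affineOp_J]
  exact UniversalEnvelopingAlgebra.lift_ι_apply' ℂ _ _

lemma rep_centralU (k κ : ℂ) : rep k κ centralU = k • 1 := by
  rw [← affineOp_central k κ]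
  exact UniversalEnvelopingAlgebra.lift_ι_apply' ℂ _ _

/-! ### Vacuum vectors: polynomials in one coordinate detect `J^0_0` -/

lemma conj_constLoop_coeff_lt {m n : ℤ} (h : n < m) (Y : Sl2) :
    (conj (constLoop m Y)).coeff n = 0 := by
  refine coeff_mul_eq_zero fun a b hab => ?_
  rw [constLoop_apply, HahnSeries.coeff_mul_single]
  rcases lt_or_ge a m with ha | ha
  · rw [genericLoop_coeff_neg (by omega), zero_mul, zero_mul]
  · rw [genericLoopInv_coeff_neg (by omega), mul_zero]

lemma conj_constLoop_coeff_zero (Y : Sl2) :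
    (conj (constLoop 0 Y)).coeff 0 = !![1, MvPolynomial.X (0, 0, 1); 0, 1] *
      Y.1.map (algebraMap ℂ CoordRing) * !![1, -MvPolynomial.X (0, 0, 1); 0, 1] := by
  rw [conj, coeff_mul_eq_single 0 0 (add_zero 0), constLoop_apply, HahnSeries.coeff_mul_single,
    sub_zero, genericLoop_coeff_zero, genericLoopInv_coeff_zero]
  intro a b hab ha
  rw [constLoop_apply, HahnSeries.coeff_mul_single]
  rcases lt_or_ge a 0 with ha | ha
  · rw [genericLoop_coeff_neg (by omega), zero_mul, zero_mul]
  · rw [genericLoopInv_coeff_neg (by omega), mul_zero]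

lemma trZero_maurerCartan_constLoop {m : ℤ} (hm : 0 ≤ m) (Y : Sl2) :
    trZero (maurerCartan * constLoop m Y) = 0 := by
  rw [trZero_apply, constLoop_apply, HahnSeries.coeff_mul_single, maurerCartan, coeff_mul_eq_zero]
  · simp
  · intro a b hab
    rcases lt_or_ge a 0 with ha | ha
    · rw [genericLoopInv_coeff_neg ha, zero_mul]
    · rcases (show b ≤ 0 by omega).lt_or_eq with hb | rfl
      · rw [euler_coeff, genericLoop_coeff_neg hb, smul_zero, mul_zero]
      · rw [euler_coeff, zero_smul, mul_zero]

lemma vectorField_posPart_X (f : LoopMat) :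
    vectorField (posPart f) (MvPolynomial.X (0, 0, 1)) = f.coeff 0 0 1 := by
  rw [vectorField_X]
  change (posPart f * genericLoop).coeff 0 0 1 = _
  rw [coeff_mul_eq_single 0 0 (add_zero 0), posPart_coeff_zero, genericLoop_coeff_zero]
  · simp [strictUpper]
  · intro a b hab ha
    rcases lt_or_gt_of_ne ha with ha | ha
    · rw [posPart_coeff_neg _ ha, zero_mul]
    · rw [genericLoop_coeff_neg (by omega), mul_zero]

/-- The vacuum vectors: functions of the finite-dimensional coordinate only. -/
def vac (n : ℕ) : CoordRing := MvPolynomial.X (0, 0, 1) ^ n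

lemma vac_ne_zero (n : ℕ) : vac n ≠ 0 := pow_ne_zero _ (MvPolynomial.X_ne_zero _)

/-- For nonnegative modes the level term has no residue, and a function of the unipotent coordinate
only sees the constant term of `g Y g⁻¹`. What remains is the action of `sl₂` on one variable `x`:
`J^0_0 = κ - x∂`, `J^+_0 = ∂`, `J^-_0 = 2κx - x²∂`. -/
lemma rep_JU_vac (k κ : ℂ) (a : Idx) {m : ℤ} (hm : 0 ≤ m) (n : ℕ) :
    rep k κ (JU a m) (vac n) = (n : CoordRing) * MvPolynomial.X (0, 0, 1) ^ (n - 1) *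
        (conj (constLoop m (gen a))).coeff 0 0 1 +
      MvPolynomial.C κ * diagZero (conj (constLoop m (gen a))) * vac n := by
  rw [rep_JU, loopOp_apply, trZero_maurerCartan_constLoop hm, smul_zero, add_zero, vac,
    Derivation.leibniz_pow, vectorField_posPart_X, MvPolynomial.smul_eq_C_mul]
  simp only [nsmul_eq_mul, smul_eq_mul]
  ring

lemma rep_JU_vac_of_pos (k κ : ℂ) (a : Idx) {m : ℤ} (hm : 0 < m) (n : ℕ) :
    rep k κ (JU a m) (vac n) = 0 := by
  rw [rep_JU_vac k κ a hm.le, diagZero_apply, conj_constLoop_coeff_lt hm]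
  simp

lemma rep_JU_zero_vac (k κ : ℂ) (n : ℕ) :
    rep k κ (JU .zero 0) (vac n) = (κ - n) • vac n := by
  rw [rep_JU_vac k κ _ le_rfl, diagZero_apply, conj_constLoop_coeff_zero]
  have h2 : (MvPolynomial.C (1 / 2) + MvPolynomial.C (1 / 2) : CoordRing) = 1 := by
    rw [← MvPolynomial.C_add]; norm_num
  have h3 : (MvPolynomial.C (-1 / 2) : CoordRing) = -MvPolynomial.C (1 / 2) := by
    rw [← MvPolynomial.C_neg]; norm_num
  simp only [gen, Matrix.mul_apply, Fin.sum_univ_two, Matrix.map_apply, Matrix.of_apply,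
    Matrix.cons_val', Matrix.cons_val_zero, Matrix.cons_val_one, Matrix.cons_val_fin_one,
    MvPolynomial.algebraMap_eq, MvPolynomial.smul_eq_C_mul, map_sub, map_zero, map_natCast, h3]
  -- The exponent `n - 1` is truncated at `n = 0`, where its coefficient vanishes.
  cases n with
  | zero => simp only [Nat.cast_zero]; linear_combination (MvPolynomial.C κ * vac 0) * h2
  | succ n =>
    simp only [vac, Nat.add_sub_cancel, pow_succ]
    linear_combination (MvPolynomial.C κ - (n + 1 : ℕ)) *
      MvPolynomial.X (0, 0, 1) ^ n * MvPolynomial.X (0, 0, 1) * h2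

lemma rep_JU_plus_vac (k κ : ℂ) (n : ℕ) :
    rep k κ (JU .plus 0) (vac n) = (n : ℂ) • vac (n - 1) := by
  rw [rep_JU_vac k κ _ le_rfl, diagZero_apply, conj_constLoop_coeff_zero]
  simp only [gen, Matrix.mul_apply, Fin.sum_univ_two, Matrix.map_apply, Matrix.of_apply,
    Matrix.cons_val', Matrix.cons_val_zero, Matrix.cons_val_one, Matrix.cons_val_fin_one,
    MvPolynomial.algebraMap_eq, MvPolynomial.smul_eq_C_mul, map_zero, map_one, map_natCast, vac]
  ring

lemma rep_JU_minus_vac (k κ : ℂ) (n : ℕ) :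
    rep k κ (JU .minus 0) (vac n) = (2 * κ - n) • vac (n + 1) := by
  rw [rep_JU_vac k κ _ le_rfl, diagZero_apply, conj_constLoop_coeff_zero]
  simp only [gen, Matrix.mul_apply, Fin.sum_univ_two, Matrix.map_apply, Matrix.of_apply,
    Matrix.cons_val', Matrix.cons_val_zero, Matrix.cons_val_one, Matrix.cons_val_fin_one,
    MvPolynomial.algebraMap_eq, MvPolynomial.smul_eq_C_mul, map_sub, map_zero, map_one,
    map_natCast, map_mul, map_ofNat]
  cases n with
  | zero => simp only [Nat.cast_zero, vac]; ring
  | succ n => simp only [vac, Nat.add_sub_cancel, pow_succ]; ring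

lemma rep_casimir_vac (k κ : ℂ) (n : ℕ) :
    rep k κ casimir (vac n) = (2 * κ * (κ + 1)) • vac n := by
  simp only [casimir, sum_idx, Klow, zero_smul, add_zero, zero_add, one_smul, map_add, map_smul,
    map_mul, LinearMap.add_apply, LinearMap.smul_apply, Module.End.mul_apply, rep_JU_zero_vac,
    rep_JU_plus_vac, rep_JU_minus_vac, smul_smul, Nat.add_sub_cancel]
  -- At `n = 0` the vector `vac (n - 1 + 1)` is not `vac n`, but it carries the coefficient zero.
  cases n with
  | zero =>
    simp only [Nat.cast_zero, zero_mul, zero_smul, add_zero, ← add_smul]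
    congr 1
    push_cast
    ring
  | succ n => simp only [Nat.add_sub_cancel, ← add_smul]; congr 1; push_cast; ring

/-- The annihilator of a vector is a left ideal, so it is enough that each generator of `W₁`, `W₂`
and `Wc` kills `vac n`; taking `κ = j` gives the Casimir its prescribed value. -/
lemma rep_eq_zero_of_cls_eq_zero {k j : ℂ} {u : U} (hu : cls k j u = 0) (n : ℕ) :
    rep k j u (vac n) = 0 := by
  have hker : ∀ S : Set U, (∀ x ∈ S, rep k j x (vac n) = 0) →
      ∀ u ∈ Submodule.span U S, rep k j u (vac n) = 0 := by
    intro S hS u hu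
    induction hu using Submodule.span_induction with
    | mem x hx => exact hS x hx
    | zero => simp
    | add x y _ _ hx hy => rw [map_add, LinearMap.add_apply, hx, hy, add_zero]
    | smul r x _ hx => rw [smul_eq_mul, map_mul, Module.End.mul_apply, hx, map_zero]
  have hmem : u ∈ W₁ ⊔ W₂ j ⊔ Wc k := by simpa [cls] using hu
  obtain ⟨v, hv, w, hw, rfl⟩ := Submodule.mem_sup.1 hmem
  obtain ⟨x, hx, y, hy, rfl⟩ := Submodule.mem_sup.1 hv
  rw [map_add, map_add, LinearMap.add_apply, LinearMap.add_apply, hker _ _ x hx, hker _ _ y hy,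
    hker _ _ w hw, add_zero, add_zero]
  · rintro _ rfl
    rw [map_sub, rep_centralU, AlgHom.commutes, LinearMap.sub_apply, LinearMap.smul_apply,
      Module.End.one_apply, Module.algebraMap_end_apply, sub_self]
  · rintro _ rfl
    rw [map_sub, AlgHom.commutes, LinearMap.sub_apply, rep_casimir_vac,
      Module.algebraMap_end_apply, sub_self]
  · rintro _ ⟨a, m, hm, rfl⟩
    exact rep_JU_vac_of_pos k j a hm n

/-- Acting on the eigenvector `vac n`, the polynomial becomes the scalar `P(j - n)`, which must
vanish for every `n`. This is the nondegeneracy statement on which the uniqueness half rests. -/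
lemma eq_zero_of_cls_aeval_eq_zero {k j : ℂ} {P : Polynomial ℂ}
    (hP : cls k j (Polynomial.aeval (JU .zero 0) P) = 0) : P = 0 := by
  have hroot : ∀ n : ℕ, P.eval (j - n) = 0 := by
    intro n
    have h := rep_eq_zero_of_cls_eq_zero hP n
    rw [← Polynomial.aeval_algHom_apply, Module.End.aeval_apply_of_hasEigenvector
      ⟨Module.End.mem_eigenspace_iff.2 (rep_JU_zero_vac k j n), vac_ne_zero n⟩] at h
    exact (smul_eq_zero.1 h).resolve_right (vac_ne_zero n)
  refine Polynomial.eq_zero_of_infinite_isRoot P ?_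
  refine Set.Infinite.mono ?_ (Set.infinite_range_of_injective
    (f := fun n : ℕ => j - (n : ℂ)) fun m n h => by simpa using h)
  rintro _ ⟨n, rfl⟩
  exact hroot n

/-! ### Charges, the Casimir, and polynomials in `J^0_0` -/

/-- The charge of `J^a_n`. -/
def charge : Idx → ℤ
  | .zero => 0
  | .plus => 1
  | .minus => -1

lemma charge_eq_of_fstr_ne_zero {a b c : Idx} (h : fstr a b c ≠ 0) :
    charge c = charge a + charge b := by
  cases a <;> cases b <;> cases c <;> simp [fstr, charge] at h ⊢

lemma charge_add_eq_zero_of_Kup_ne_zero {a b : Idx} (h : Kup a b ≠ 0) :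
    charge a + charge b = 0 := by
  cases a <;> cases b <;> simp [Kup, form_apply, gen, charge, Matrix.trace_fin_two] at h ⊢

lemma JU_zero_mul (a : Idx) (n : ℤ) :
    JU .zero 0 * JU a n = JU a n * JU .zero 0 + (charge a : ℂ) • JU a n := by
  rw [JU_mul]
  cases a <;> simp [sum_idx, fstr, charge]

/-- Together with `minus_mul_plus`, this lets opposite zero modes be traded for the Casimir and a
quadratic in `J^0_0`, so that mixed words never survive in the quotient. -/
lemma plus_mul_minus : JU .plus 0 * JU .minus 0 =
    (1 / 2 : ℂ) • casimir + (JU .zero 0 - JU .zero 0 * JU .zero 0) := by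
  have h := JU_mul .plus .minus 0 0
  simp only [sum_idx, fstr, Int.cast_zero, zero_mul, ite_self, zero_smul, add_zero] at h
  simp only [casimir, sum_idx, Klow, zero_smul, add_zero, zero_add, one_smul]
  rw [h]
  module

lemma minus_mul_plus : JU .minus 0 * JU .plus 0 =
    (1 / 2 : ℂ) • casimir - (JU .zero 0 + JU .zero 0 * JU .zero 0) := by
  have h := JU_mul .plus .minus 0 0
  simp only [sum_idx, fstr, Int.cast_zero, zero_mul, ite_self, zero_smul, add_zero] at h
  simp only [casimir, sum_idx, Klow, zero_smul, add_zero, zero_add, one_smul]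
  rw [h]
  module

lemma commute_casimir (a : Idx) : Commute casimir (JU a 0) := by
  have h1 := JU_zero_mul .plus 0
  have h2 := JU_zero_mul .minus 0
  have e1 : casimir = (2 : ℂ) • (JU .plus 0 * JU .minus 0) -
      (2 : ℂ) • (JU .zero 0 - JU .zero 0 * JU .zero 0) := by
    rw [plus_mul_minus]; module
  have e2 : casimir = (2 : ℂ) • (JU .minus 0 * JU .plus 0) +
      (2 : ℂ) • (JU .zero 0 + JU .zero 0 * JU .zero 0) := by
    rw [minus_mul_plus]; module
  simp only [charge, Int.cast_one, Int.cast_neg, one_smul, neg_smul] at h1 h2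
  cases a with
  | zero => exact casimir_comm
  | plus =>
    have h3 : (JU .zero 0 - JU .zero 0 * JU .zero 0) * JU .plus 0 =
        -(JU .plus 0 * (JU .zero 0 + JU .zero 0 * JU .zero 0)) := by
      rw [sub_mul, mul_assoc, h1, mul_add, ← mul_assoc, h1]
      noncomm_ring
    calc casimir * JU .plus 0
        = (2 : ℂ) • (JU .plus 0 * (JU .minus 0 * JU .plus 0)) -
          (2 : ℂ) • ((JU .zero 0 - JU .zero 0 * JU .zero 0) * JU .plus 0) := by
          rw [e1, sub_mul, smul_mul_assoc, smul_mul_assoc, mul_assoc]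
      _ = JU .plus 0 * casimir := by
          rw [h3, e2]
          simp only [mul_add, mul_smul_comm, smul_neg, smul_add, neg_add]
          abel
  | minus =>
    have h3 : (JU .zero 0 + JU .zero 0 * JU .zero 0) * JU .minus 0 =
        -(JU .minus 0 * (JU .zero 0 - JU .zero 0 * JU .zero 0)) := by
      rw [add_mul, mul_assoc, h2, mul_add, ← mul_assoc]
      simp only [mul_neg, h2]
      noncomm_ring
    calc casimir * JU .minus 0
        = (2 : ℂ) • (JU .minus 0 * (JU .plus 0 * JU .minus 0)) +
          (2 : ℂ) • ((JU .zero 0 + JU .zero 0 * JU .zero 0) * JU .minus 0) := by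
          rw [e2, add_mul, smul_mul_assoc, smul_mul_assoc, mul_assoc]
      _ = JU .minus 0 * casimir := by
          rw [h3, e1]
          simp only [mul_sub, mul_smul_comm, smul_sub, neg_sub]
          abel

/-- A polynomial in `J^0_0`. -/
def polyH (p : Polynomial ℂ) : U := Polynomial.aeval (JU .zero 0) p

lemma commute_polyH {u : U} (h : Commute u (JU .zero 0)) (p : Polynomial ℂ) :
    Commute u (polyH p) := by
  refine Polynomial.induction_on' p (fun p q hp hq => ?_) (fun n c => ?_)
  · rw [polyH, map_add]; exact hp.add_right hq
  · rw [polyH, Polynomial.aeval_monomial]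
    exact (Algebra.commute_algebraMap_right c u).mul_right (h.pow_right n)

lemma polyH_add (p q : Polynomial ℂ) : polyH (p + q) = polyH p + polyH q := map_add _ _ _

lemma polyH_zero : polyH 0 = 0 := map_zero _

lemma polyH_mul (p q : Polynomial ℂ) : polyH (p * q) = polyH p * polyH q := map_mul _ _ _

lemma polyH_X : polyH Polynomial.X = JU .zero 0 := Polynomial.aeval_X _

lemma polyH_C (c : ℂ) : polyH (Polynomial.C c) = algebraMap ℂ U c := Polynomial.aeval_C _ _

/-- `p(J^0_0) (J^a_0)^n = (J^a_0)^n p(J^0_0 + n q_a)`. -/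
lemma polyH_mul_pow (a : Idx) (n : ℕ) (p : Polynomial ℂ) : polyH p * JU a 0 ^ n =
    JU a 0 ^ n * polyH (p.comp (Polynomial.X + Polynomial.C (n * charge a : ℂ))) := by
  have hX : JU .zero 0 * JU a 0 ^ n = JU a 0 ^ n * (JU .zero 0 + algebraMap ℂ U (n * charge a)) := by
    induction n with
    | zero => simp
    | succ n ih =>
      rw [pow_succ, ← mul_assoc, ih, mul_assoc, mul_assoc, add_mul, JU_zero_mul,
        Algebra.commutes (n * charge a : ℂ) (JU a 0), Algebra.smul_def,
        Algebra.commutes (charge a : ℂ) (JU a 0)]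
      simp only [Nat.cast_succ, add_mul, one_mul, map_add, mul_add]
      abel
  refine Polynomial.induction_on' p (fun p q hp hq => ?_) (fun m c => ?_)
  · rw [Polynomial.add_comp]
    simp only [polyH, map_add, add_mul, mul_add] at hp hq ⊢
    rw [hp, hq]
  · simp only [polyH, Polynomial.monomial_comp, Polynomial.aeval_monomial, map_mul, map_pow,
      map_add, Polynomial.aeval_C, Polynomial.aeval_X]
    rw [← mul_assoc (JU a 0 ^ n), ← Algebra.commutes c (JU a 0 ^ n), mul_assoc, mul_assoc]
    congr 1
    induction m with
    | zero => simp
    | succ m ih =>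
      simp only [map_mul] at hX ih
      rw [pow_succ', mul_assoc, ih, ← mul_assoc, hX, pow_succ', ← mul_assoc]

variable {k j : ℂ}

lemma cls_mul (u v : U) : cls k j (u * v) = u • cls k j v := by
  rw [← smul_eq_mul, map_smul]

lemma cls_smul (c : ℂ) (u : U) : cls k j (c • u) = c • cls k j u := by
  rw [Algebra.smul_def, cls_mul, algebraMap_smul]

lemma smul_smul_comm (u : U) (c : ℂ) (x : NullVectorSpace k j) : u • c • x = c • u • x := by
  rw [← algebraMap_smul U c x, ← algebraMap_smul U c (u • x), smul_smul, smul_smul,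
    Algebra.commutes]

lemma cls_casimir_mul {u : U} (h : Commute casimir u) :
    cls k j (casimir * u) = (2 * j * (j + 1)) • cls k j u := by
  have h0 : cls k j (casimir - algebraMap ℂ U (2 * j * (j + 1))) = 0 :=
    (Submodule.Quotient.mk_eq_zero _).2 (Submodule.mem_sup_left (Submodule.mem_sup_right
      (Submodule.subset_span rfl)))
  have h1 := congrArg (u • ·) h0
  simp only [smul_zero, ← cls_mul] at h1
  rw [mul_sub, ← h.eq, map_sub, sub_eq_zero] at h1
  rw [h1, ← Algebra.commutes, ← Algebra.smul_def, cls_smul]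

lemma cls_central : cls k j centralU = k • cls k j 1 := by
  have h0 : cls k j (centralU - algebraMap ℂ U k) = 0 :=
    (Submodule.Quotient.mk_eq_zero _).2 (Submodule.mem_sup_right (Submodule.subset_span rfl))
  rw [map_sub, sub_eq_zero] at h0
  rw [h0, ← mul_one (algebraMap ℂ U k), ← Algebra.smul_def, cls_smul]

lemma cls_pos (a : Idx) {n : ℤ} (hn : 0 < n) : cls k j (JU a n) = 0 :=
  (Submodule.Quotient.mk_eq_zero _).2 (Submodule.mem_sup_left (Submodule.mem_sup_left
      (Submodule.subset_span ⟨a, n, hn, rfl⟩)))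

/-! ### Spanning by ordered products, graded by level and charge -/

/-- Products of negative modes applied to `(J^±_0)^n p(J^0_0)`, with their level and charge. -/
inductive Homog (k j : ℂ) : ℤ → ℤ → NullVectorSpace k j → Prop
  | up (n : ℕ) (p : Polynomial ℂ) : Homog k j 0 n (cls k j (JU .plus 0 ^ n * polyH p))
  | down (n : ℕ) (p : Polynomial ℂ) : Homog k j 0 (-n) (cls k j (JU .minus 0 ^ n * polyH p))
  | desc {N q : ℤ} {x : NullVectorSpace k j} (a : Idx) {m : ℤ} (hm : 0 < m)
      (hx : Homog k j N q x) : Homog k j (N + m) (q + charge a) (JU a (-m) • x)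

lemma Homog.congr {N q N' q' : ℤ} {x y : NullVectorSpace k j} (h : Homog k j N q x)
    (hN : N = N') (hq : q = q') (hx : x = y) : Homog k j N' q' y := by
  subst hN hq hx; exact h

lemma Homog.level_nonneg {N q : ℤ} {x : NullVectorSpace k j} (h : Homog k j N q x) : 0 ≤ N := by
  induction h with
  | up => exact le_rfl
  | down => exact le_rfl
  | desc a hm _ ih => omega

/-- The span of the homogeneous elements of level `N` and charge `q`. -/
def homogSpan (k j : ℂ) (N q : ℤ) : Submodule ℂ (NullVectorSpace k j) :=
  Submodule.span ℂ {x | Homog k j N q x}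

lemma Homog.mem {N q : ℤ} {x : NullVectorSpace k j} (h : Homog k j N q x) :
    x ∈ homogSpan k j N q := Submodule.subset_span h

lemma JU_smul_mem_of_forall_homog {a : Idx} {m N q N' q' : ℤ}
    (h : ∀ x, Homog k j N q x → JU a m • x ∈ homogSpan k j N' q') {y : NullVectorSpace k j}
    (hy : y ∈ homogSpan k j N q) : JU a m • y ∈ homogSpan k j N' q' := by
  induction hy using Submodule.span_induction with
  | mem x hx => exact h x hx
  | zero => rw [smul_zero]; exact Submodule.zero_mem _
  | add x y _ _ hx hy => rw [smul_add]; exact Submodule.add_mem _ hx hy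
  | smul c x _ hx => rw [smul_smul_comm]; exact Submodule.smul_mem _ c hx

lemma centralU_smul_cls {u : U} (h : Commute centralU u) :
    centralU • cls k j u = k • cls k j u := by
  rw [← cls_mul, h.eq, cls_mul, cls_central, smul_smul_comm, ← cls_mul, mul_one]

lemma Homog.central_smul {N q : ℤ} {x : NullVectorSpace k j} (h : Homog k j N q x) :
    centralU • x = k • x := by
  have hc : ∀ a n, Commute centralU (JU a n) := centralU_comm
  induction h with
  | up n p => exact centralU_smul_cls (((hc _ _).pow_right n).mul_right (commute_polyH (hc _ _) p))
  | down n p =>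
    exact centralU_smul_cls (((hc _ _).pow_right n).mul_right (commute_polyH (hc _ _) p))
  | desc a hm hx ih => rw [smul_smul, (hc _ _).eq, ← smul_smul, ih, smul_smul_comm]

lemma JU_smul_JU_smul (a b : Idx) (n m : ℤ) (x : NullVectorSpace k j) :
    JU a n • JU b m • x = JU b m • JU a n • x + (∑ c, fstr a b c • JU c (n + m) • x +
      (if n + m = 0 then (n : ℂ) * Kup a b else 0) • centralU • x) := by
  rw [smul_smul, JU_mul, add_smul, add_smul, Finset.sum_smul, smul_smul, smul_assoc]
  simp only [smul_assoc]

/-- Commuting a mode of index `m > 0` past a zero mode produces only modes of the same index and no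
central term, so everything can be pushed onto the vacuum class. -/
lemma JU_pos_smul_cls {u : U} (hu : u ∈ Algebra.adjoin ℂ {x | ∃ a, x = JU a 0}) (a : Idx) {m : ℤ}
    (hm : 0 < m) : JU a m • cls k j u = 0 := by
  -- Strengthened from the vacuum class to an arbitrary vector killed by the modes of index `m`, so
  -- that the induction passes through products.
  have key : ∀ y : NullVectorSpace k j, (∀ a, JU a m • y = 0) → ∀ a, JU a m • u • y = 0 := by
    induction hu using Algebra.adjoin_induction with
    | mem x hx =>
      obtain ⟨b, rfl⟩ := hx
      intro y hy a
      rw [JU_smul_JU_smul, hy, smul_zero, zero_add, if_neg (by omega), zero_smul, add_zero,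
        add_zero]
      exact Finset.sum_eq_zero fun c _ => by rw [hy, smul_zero]
    | algebraMap r => intro y hy a; rw [algebraMap_smul, smul_smul_comm, hy, smul_zero]
    | add x y _ _ hx hy => intro z hz a; rw [add_smul, smul_add, hx z hz, hy z hz, add_zero]
    | mul x y _ _ hx hy => intro z hz a; rw [mul_smul]; exact hx _ (hy z hz) a
  have h1 := key (cls k j 1) (fun a => by rw [← cls_mul, mul_one, cls_pos a hm]) a
  rwa [← cls_mul u, mul_one] at h1

lemma pow_mul_polyH_mem_adjoin (a : Idx) (n : ℕ) (p : Polynomial ℂ) :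
    JU a 0 ^ n * polyH p ∈ Algebra.adjoin ℂ {x | ∃ a, x = JU a 0} := by
  have h : ∀ a, JU a 0 ∈ Algebra.adjoin ℂ {x | ∃ a, x = JU a 0} :=
    fun a => Algebra.subset_adjoin ⟨a, rfl⟩
  refine mul_mem (pow_mem (h a) n) ?_
  exact Algebra.adjoin_mono (by rintro _ rfl; exact ⟨_, rfl⟩)
    (Polynomial.aeval_mem_adjoin_singleton ℂ (JU .zero 0))

/-- The Casimir commutes with zero modes, so it reaches the right end and becomes a number there;
`s` is moved through `(J^a_0)ⁿ` by a shift of its argument. This covers both products of opposite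
zero modes. -/
lemma cls_casimir_add (a : Idx) (n : ℕ) (p s : Polynomial ℂ) :
    cls k j ((1 / 2 : ℂ) • (casimir * (JU a 0 ^ n * polyH p)) +
        polyH s * JU a 0 ^ n * polyH p) =
      cls k j (JU a 0 ^ n * polyH ((Polynomial.C (j * (j + 1)) +
        s.comp (Polynomial.X + Polynomial.C (n * charge a : ℂ))) * p)) := by
  have hc : Commute casimir (JU a 0 ^ n * polyH p) :=
    ((commute_casimir _).pow_right n).mul_right (commute_polyH (commute_casimir _) p)
  have h1 : JU a 0 ^ n * polyH ((Polynomial.C (j * (j + 1)) +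
      s.comp (Polynomial.X + Polynomial.C (n * charge a : ℂ))) * p) =
      (j * (j + 1)) • (JU a 0 ^ n * polyH p) + polyH s * JU a 0 ^ n * polyH p := by
    rw [polyH_mul_pow, add_mul, polyH_add, mul_add (JU a 0 ^ n), polyH_mul, polyH_mul, polyH_C,
      ← Algebra.smul_def, mul_smul_comm, mul_assoc]
  rw [h1, map_add, map_add, cls_smul, cls_smul, cls_casimir_mul hc, smul_smul,
    show 1 / 2 * (2 * j * (j + 1)) = j * (j + 1) by ring]

lemma cls_plus_mul_minus_pow (n : ℕ) (p : Polynomial ℂ) : ∃ r : Polynomial ℂ,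
    cls k j (JU .plus 0 * (JU .minus 0 ^ (n + 1) * polyH p)) =
      cls k j (JU .minus 0 ^ n * polyH r) := by
  refine ⟨_, Eq.trans ?_
    (cls_casimir_add .minus n p (Polynomial.X - Polynomial.X * Polynomial.X))⟩
  rw [pow_succ', mul_assoc, ← mul_assoc, plus_mul_minus, add_mul, smul_mul_assoc,
    mul_assoc _ _ (polyH p)]
  simp [polyH]

lemma cls_minus_mul_plus_pow (n : ℕ) (p : Polynomial ℂ) : ∃ r : Polynomial ℂ,
    cls k j (JU .minus 0 * (JU .plus 0 ^ (n + 1) * polyH p)) =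
      cls k j (JU .plus 0 ^ n * polyH r) := by
  refine ⟨_, Eq.trans ?_
    (cls_casimir_add .plus n p (-(Polynomial.X + Polynomial.X * Polynomial.X)))⟩
  rw [pow_succ', mul_assoc, ← mul_assoc, minus_mul_plus, sub_eq_add_neg, add_mul, smul_mul_assoc,
    mul_assoc _ _ (polyH p)]
  simp only [polyH, map_neg, map_add, map_mul, Polynomial.aeval_X]

lemma JU_zero_smul_cls (a : Idx) (n : ℕ) (p : Polynomial ℂ) : ∃ r : Polynomial ℂ,
    JU .zero 0 • cls k j (JU a 0 ^ n * polyH p) = cls k j (JU a 0 ^ n * polyH r) :=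
  ⟨_, by rw [← cls_mul, ← mul_assoc, ← polyH_X, polyH_mul_pow, mul_assoc, ← polyH_mul]⟩

lemma Homog.JU_smul_mem_of_neg {N q : ℤ} {x : NullVectorSpace k j} (h : Homog k j N q x) (a : Idx)
    {m : ℤ} (hm : m < 0) : JU a m • x ∈ homogSpan k j (N - m) (q + charge a) := by
  have := (h.desc a (neg_pos.2 hm)).mem
  rwa [neg_neg, ← sub_eq_add_neg] at this

lemma JU_zero_smul_up_mem (a : Idx) (n : ℕ) (p : Polynomial ℂ) :
    JU a 0 • cls k j (JU .plus 0 ^ n * polyH p) ∈ homogSpan k j 0 (n + charge a) := by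
  cases a with
  | zero =>
    obtain ⟨r, hr⟩ := JU_zero_smul_cls (k := k) (j := j) .plus n p
    rw [hr]
    exact ((Homog.up n r).congr rfl (add_zero _).symm rfl).mem
  | plus =>
    rw [← cls_mul, ← mul_assoc, ← pow_succ']
    exact ((Homog.up (n + 1) p).congr rfl (Nat.cast_succ n) rfl).mem
  | minus =>
    cases n with
    | zero =>
      -- With no `J^+_0` left to cancel, the lowering mode crosses over to the `down` family.
      rw [← cls_mul, pow_zero, one_mul, ← pow_one (JU .minus 0)]
      exact ((Homog.down 1 p).congr rfl rfl rfl).mem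
    | succ n =>
      obtain ⟨r, hr⟩ := cls_minus_mul_plus_pow (k := k) (j := j) n p
      rw [← cls_mul, hr]
      exact ((Homog.up n r).congr rfl (by simp [charge]) rfl).mem

lemma JU_zero_smul_down_mem (a : Idx) (n : ℕ) (p : Polynomial ℂ) :
    JU a 0 • cls k j (JU .minus 0 ^ n * polyH p) ∈ homogSpan k j 0 (-n + charge a) := by
  cases a with
  | zero =>
    obtain ⟨r, hr⟩ := JU_zero_smul_cls (k := k) (j := j) .minus n p
    rw [hr]
    exact ((Homog.down n r).congr rfl (add_zero _).symm rfl).mem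
  | minus =>
    rw [← cls_mul, ← mul_assoc, ← pow_succ']
    exact ((Homog.down (n + 1) p).congr rfl (by simp [charge]; ring) rfl).mem
  | plus =>
    cases n with
    | zero =>
      rw [← cls_mul, pow_zero, one_mul, ← pow_one (JU .plus 0)]
      exact ((Homog.up 1 p).congr rfl rfl rfl).mem
    | succ n =>
      obtain ⟨r, hr⟩ := cls_plus_mul_minus_pow (k := k) (j := j) n p
      rw [← cls_mul, hr]
      exact ((Homog.down n r).congr rfl (by simp [charge]) rfl).mem

/-- Negative modes preserve the family by construction. A nonnegative mode is commuted to the right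
through the negative ones until it meets the zero modes; the structure constants and the form
respect charge, so the grading persists. -/
lemma Homog.JU_smul_mem {N q : ℤ} {x : NullVectorSpace k j} (h : Homog k j N q x) (a : Idx)
    (m : ℤ) : JU a m • x ∈ homogSpan k j (N - m) (q + charge a) := by
  rcases lt_or_ge m 0 with hm | hm
  · exact h.JU_smul_mem_of_neg a hm
  induction h generalizing a m with
  | up n p =>
    rcases hm.lt_or_eq with hm | rfl
    · rw [JU_pos_smul_cls (pow_mul_polyH_mem_adjoin _ n p) a hm]; exact Submodule.zero_mem _
    · rw [sub_zero]; exact JU_zero_smul_up_mem a n p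
  | down n p =>
    rcases hm.lt_or_eq with hm | rfl
    · rw [JU_pos_smul_cls (pow_mul_polyH_mem_adjoin _ n p) a hm]; exact Submodule.zero_mem _
    · rw [sub_zero]; exact JU_zero_smul_down_mem a n p
  | @desc N q x b l hl hx ih =>
    -- The commutator produces the index `m - l`, which may have either sign, so modes of all
    -- indices on `x` are needed.
    have hany : ∀ c m, JU c m • x ∈ homogSpan k j (N - m) (q + charge c) := fun c m => by
      rcases lt_or_ge m 0 with hm | hm
      · exact hx.JU_smul_mem_of_neg c hm
      · exact ih c m hm
    rw [JU_smul_JU_smul]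
    refine Submodule.add_mem _ ?_ (Submodule.add_mem _ (Submodule.sum_mem _ fun c _ => ?_) ?_)
    · refine JU_smul_mem_of_forall_homog (fun y hy => ?_) (hany a m)
      have h1 := hy.JU_smul_mem_of_neg b (neg_neg_of_pos hl)
      rwa [show N - m - -l = N + l - m by ring, add_right_comm] at h1
    · by_cases hf : fstr a b c = 0
      · rw [hf, zero_smul]; exact Submodule.zero_mem _
      · have h1 := hany c (m + -l)
        rw [charge_eq_of_fstr_ne_zero hf, show N - (m + -l) = N + l - m by ring,
          show q + (charge a + charge b) = q + charge b + charge a by ring] at h1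
        exact Submodule.smul_mem _ _ h1
    · by_cases hK : m + -l = 0 ∧ Kup a b ≠ 0
      · rw [hx.central_smul]
        refine Submodule.smul_mem _ _ (Submodule.smul_mem _ _ (hx.congr ?_ ?_ rfl).mem)
        · omega
        · have := charge_add_eq_zero_of_Kup_ne_zero hK.2
          omega
      · have h0 : (if m + -l = 0 then (m : ℂ) * Kup a b else 0) = 0 := by
          split_ifs with h
          · rw [not_not.1 fun h1 => hK ⟨h, h1⟩, mul_zero]
          · rfl
        rw [h0, zero_smul]
        exact Submodule.zero_mem _

lemma cls_prod_mem (l : List (Idx × ℤ)) : ∃ q : ℤ,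
    cls k j (l.map fun x => JU x.1 x.2).prod ∈ homogSpan k j (-(l.map Prod.snd).sum) q := by
  induction l with
  | nil =>
    refine ⟨0, ((Homog.up 0 1).congr (by simp) (by simp) ?_).mem⟩
    simp [polyH]
  | cons x l ih =>
    obtain ⟨q, hq⟩ := ih
    refine ⟨q + charge x.1, ?_⟩
    simp only [List.map_cons, List.prod_cons, cls_mul, List.sum_cons, neg_add_rev]
    rw [← sub_eq_add_neg]
    exact JU_smul_mem_of_forall_homog (fun y hy => hy.JU_smul_mem x.1 x.2) hq

lemma levelSpace_le (N : ℤ) : levelSpace k j N ≤ ⨆ q, homogSpan k j N q := by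
  refine Submodule.span_le.2 ?_
  rintro _ ⟨l, rfl, rfl⟩
  obtain ⟨q, hq⟩ := cls_prod_mem (k := k) (j := j) l
  exact Submodule.mem_iSup_of_mem q hq

/-! ### Separating charges by eigenspaces of the adjoint action -/

lemma ad_cls (u : U) : ad k j (cls k j u) = cls k j (JU .zero 0 * u - u * JU .zero 0) := rfl

lemma ad_JU_smul (a : Idx) (m : ℤ) (x : NullVectorSpace k j) :
    ad k j (JU a m • x) = JU a m • ad k j x + (charge a : ℂ) • JU a m • x := by
  obtain ⟨u, rfl⟩ := Submodule.mkQ_surjective _ x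
  change ad k j (JU a m • cls k j u) = JU a m • ad k j (cls k j u) + _ • JU a m • cls k j u
  rw [← cls_mul, ad_cls, ad_cls, ← cls_mul, ← cls_smul, ← map_add, ← mul_assoc, JU_zero_mul,
    add_mul, smul_mul_assoc]
  congr 1
  noncomm_ring

lemma ad_cls_pow_mul_polyH (a : Idx) (n : ℕ) (p : Polynomial ℂ) :
    ad k j (cls k j (JU a 0 ^ n * polyH p)) =
      (n * charge a : ℂ) • cls k j (JU a 0 ^ n * polyH p) := by
  induction n with
  | zero =>
    rw [ad_cls, pow_zero, one_mul, (commute_polyH (Commute.refl _) p).eq, sub_self, map_zero]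
    simp
  | succ n ih =>
    rw [pow_succ', mul_assoc, cls_mul, ad_JU_smul, ih, smul_smul_comm, ← add_smul]
    congr 1
    push_cast
    ring

lemma Homog.ad_eq {N q : ℤ} {x : NullVectorSpace k j} (h : Homog k j N q x) :
    ad k j x = (q : ℂ) • x := by
  induction h with
  | up n p => rw [ad_cls_pow_mul_polyH]; simp [charge]
  | down n p => rw [ad_cls_pow_mul_polyH]; simp [charge]
  | desc a hm _ ih => rw [ad_JU_smul, ih, smul_smul_comm, ← add_smul]; push_cast; rfl

lemma homogSpan_le_chargeSpace (N q : ℤ) : homogSpan k j N q ≤ chargeSpace k j q :=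
  Submodule.span_le.2 fun _ hx => Module.End.mem_eigenspace_iff.2 (Homog.ad_eq hx)

/-- Level `N` is contained in the sum of its charge pieces, which lie in independent eigenspaces;
hence all components of other charge vanish. -/
lemma mem_homogSpan_of_mem_levelSpace {N q : ℤ} {T : NullVectorSpace k j}
    (h1 : T ∈ levelSpace k j N) (h2 : T ∈ chargeSpace k j q) : T ∈ homogSpan k j N q := by
  have hind : iSupIndep fun q : ℤ => chargeSpace k j q :=
    (Module.End.eigenspaces_iSupIndep (ad k j)).comp (f := fun q : ℤ => (q : ℂ)) Int.cast_injective
  have hT := levelSpace_le N h1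
  rw [iSup_split_single _ q] at hT
  obtain ⟨x, hx, y, hy, rfl⟩ := Submodule.mem_sup.1 hT
  have hy2 : y ∈ chargeSpace k j q := by
    have := Submodule.sub_mem _ h2 (homogSpan_le_chargeSpace N q hx)
    rwa [add_sub_cancel_left] at this
  have hy3 : y ∈ ⨆ q', ⨆ _ : q' ≠ q, chargeSpace k j (q' : ℤ) :=
    iSup₂_mono (fun q' _ => homogSpan_le_chargeSpace N q') hy
  have hy0 : y = 0 := Submodule.disjoint_def.1 (hind q) y hy2 hy3
  rwa [hy0, add_zero]

lemma Homog.of_level_zero {q : ℤ} {x : NullVectorSpace k j} (h : Homog k j 0 q x) :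
    (∃ (n : ℕ) (p : Polynomial ℂ), q = n ∧ x = cls k j (JU .plus 0 ^ n * polyH p)) ∨
    ∃ (n : ℕ) (p : Polynomial ℂ), q = -n ∧ x = cls k j (JU .minus 0 ^ n * polyH p) := by
  generalize hN : (0 : ℤ) = N at h
  cases h with
  | up n p => exact Or.inl ⟨n, p, rfl, rfl⟩
  | down n p => exact Or.inr ⟨n, p, rfl, rfl⟩
  | desc a hm hx => have := hx.level_nonneg; omega

/-! ### Level one, charge zero: action of the modes of index one -/

/-- The general element of level one and charge zero. -/
def levelOne (p p₁ p₂ : Polynomial ℂ) : U :=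
  JU .zero (-1) * polyH p + JU .plus (-1) * (JU .minus 0 * polyH p₁) +
    JU .minus (-1) * (JU .plus 0 * polyH p₂)

/-- Level one leaves room for exactly one negative mode, of index `-1`; charge zero then forces the
accompanying power of `J^±_0` to be at most one and of opposite charge. -/
lemma Homog.exists_levelOne {x : NullVectorSpace k j} (h : Homog k j 1 0 x) :
    ∃ p p₁ p₂, x = cls k j (levelOne p p₁ p₂) := by
  generalize hN : (1 : ℤ) = N at h
  generalize hQ : (0 : ℤ) = Q at h
  cases h with
  | up => omega
  | down => omega
  | @desc N q x a m hm hx =>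
    have h0 := hx.level_nonneg
    obtain rfl : N = 0 := by omega
    obtain rfl : m = 1 := by omega
    rcases hx.of_level_zero with ⟨n, p, rfl, rfl⟩ | ⟨n, p, rfl, rfl⟩
    · cases a with
      | zero =>
        obtain rfl : n = 0 := by simpa [charge, eq_comm] using hQ
        exact ⟨p, 0, 0, by simp [levelOne, polyH_zero, cls_mul]⟩
      | plus => simp only [charge] at hQ; omega
      | minus =>
        obtain rfl : n = 1 := by simp only [charge] at hQ; omega
        exact ⟨0, 0, p, by simp [levelOne, polyH_zero, cls_mul]⟩
    · cases a with
      | zero =>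
        obtain rfl : n = 0 := by simpa [charge, eq_comm] using hQ
        exact ⟨p, 0, 0, by simp [levelOne, polyH_zero, cls_mul]⟩
      | minus => simp only [charge] at hQ; omega
      | plus =>
        obtain rfl : n = 1 := by simp only [charge] at hQ; omega
        exact ⟨0, p, 0, by simp [levelOne, polyH_zero, cls_mul]⟩

lemma exists_levelOne_of_mem {T : NullVectorSpace k j} (h : T ∈ homogSpan k j 1 0) :
    ∃ p p₁ p₂, T = cls k j (levelOne p p₁ p₂) := by
  induction h using Submodule.span_induction with
  | mem x hx => exact Homog.exists_levelOne hx
  | zero => exact ⟨0, 0, 0, by simp [levelOne, polyH_zero]⟩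
  | add x y _ _ hx hy =>
    obtain ⟨p, p₁, p₂, rfl⟩ := hx
    obtain ⟨q, q₁, q₂, rfl⟩ := hy
    refine ⟨p + q, p₁ + q₁, p₂ + q₂, ?_⟩
    rw [← map_add]
    congr 1
    simp only [levelOne, polyH_add, mul_add]
    abel
  | smul c x _ hx =>
    obtain ⟨p, p₁, p₂, rfl⟩ := hx
    refine ⟨c • p, c • p₁, c • p₂, ?_⟩
    rw [← cls_smul]
    simp only [levelOne, polyH, map_smul, smul_add, mul_smul_comm]

lemma cls_add (u v : U) : cls k j (u + v) = cls k j u + cls k j v := map_add _ _ _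

/-- Moving `J^b_1` to the right, it annihilates the zero mode vector, so only the commutator with
`J^a_{-1}` contributes. -/
lemma cls_JU_one_mul (b a a' : Idx) (n : ℕ) (p : Polynomial ℂ) :
    cls k j (JU b 1 * (JU a (-1) * (JU a' 0 ^ n * polyH p))) =
      cls k j ((∑ c, fstr b a c • (JU c 0 * (JU a' 0 ^ n * polyH p))) +
        (k * Kup b a) • (JU a' 0 ^ n * polyH p)) := by
  have hc : ∀ a n, Commute centralU (JU a n) := centralU_comm
  have hv := pow_mul_polyH_mem_adjoin a' n p
  have hcv : Commute centralU (JU a' 0 ^ n * polyH p) :=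
    ((hc _ _).pow_right n).mul_right (commute_polyH (hc _ _) p)
  generalize JU a' 0 ^ n * polyH p = v at hv hcv ⊢
  have h1 : cls k j (JU a (-1) * (JU b 1 * v)) = 0 := by
    rw [cls_mul, cls_mul, JU_pos_smul_cls hv b one_pos, smul_zero]
  have h2 : cls k j ((Kup b a) • (centralU * v)) = cls k j ((k * Kup b a) • v) := by
    rw [cls_smul, cls_smul, cls_mul, centralU_smul_cls hcv, smul_smul, mul_comm k]
  have h3 : JU b 1 * (JU a (-1) * v) = JU a (-1) * (JU b 1 * v) +
      ((∑ c, fstr b a c • (JU c 0 * v)) + Kup b a • (centralU * v)) := by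
    rw [← mul_assoc, JU_mul, add_mul, add_mul, mul_assoc, Finset.sum_mul]
    simp only [add_neg_cancel, if_true, Int.cast_one, one_mul, smul_mul_assoc]
  rw [h3, cls_add, cls_add, h1, h2, zero_add, cls_add]

lemma cls_plus_minus_polyH (p : Polynomial ℂ) :
    cls k j (JU .plus 0 * (JU .minus 0 * polyH p)) = cls k j (polyH
      ((Polynomial.C (j * (j + 1)) + (Polynomial.X - Polynomial.X * Polynomial.X)) * p)) := by
  have h := cls_casimir_add (k := k) (j := j) .minus 0 p
    (Polynomial.X - Polynomial.X * Polynomial.X)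
  rw [Nat.cast_zero, zero_mul, Polynomial.C_0, add_zero, Polynomial.comp_X, pow_zero, one_mul,
    one_mul, mul_one] at h
  rw [← h, ← mul_assoc, plus_mul_minus, add_mul, smul_mul_assoc]
  simp only [polyH, map_sub, map_mul, Polynomial.aeval_X]

lemma cls_minus_plus_polyH (p : Polynomial ℂ) :
    cls k j (JU .minus 0 * (JU .plus 0 * polyH p)) = cls k j (polyH
      ((Polynomial.C (j * (j + 1)) - (Polynomial.X + Polynomial.X * Polynomial.X)) * p)) := by
  have h := cls_casimir_add (k := k) (j := j) .plus 0 p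
    (-(Polynomial.X + Polynomial.X * Polynomial.X))
  rw [Nat.cast_zero, zero_mul, Polynomial.C_0, add_zero, Polynomial.comp_X, pow_zero, one_mul,
    one_mul, mul_one, ← sub_eq_add_neg] at h
  rw [← h, ← mul_assoc, minus_mul_plus, sub_eq_add_neg, add_mul, smul_mul_assoc]
  simp only [polyH, map_neg, map_add, map_mul, Polynomial.aeval_X]

lemma polyH_smul (c : ℂ) (p : Polynomial ℂ) : polyH (Polynomial.C c * p) = c • polyH p := by
  rw [polyH_mul, polyH_C, Algebra.smul_def]

lemma polyH_sub (p q : Polynomial ℂ) : polyH (p - q) = polyH p - polyH q := map_sub _ _ _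

lemma zero_mul_mul_polyH (a : Idx) (p : Polynomial ℂ) : JU .zero 0 * (JU a 0 * polyH p) =
    JU a 0 * polyH ((Polynomial.X + Polynomial.C (charge a : ℂ)) * p) := by
  have h := polyH_mul_pow a 1 Polynomial.X
  rw [pow_one, polyH_X, Polynomial.X_comp, Nat.cast_one, one_mul] at h
  rw [← mul_assoc, h, mul_assoc, ← polyH_mul]

lemma Kup_values : Kup .zero .zero = 1 / 2 ∧ Kup .zero .plus = 0 ∧ Kup .zero .minus = 0 ∧
    Kup .plus .zero = 0 ∧ Kup .plus .plus = 0 ∧ Kup .plus .minus = 1 ∧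
    Kup .minus .zero = 0 ∧ Kup .minus .plus = 1 ∧ Kup .minus .minus = 0 := by
  refine ⟨?_, ?_, ?_, ?_, ?_, ?_, ?_, ?_, ?_⟩ <;>
    simp [Kup, form_apply, gen, Matrix.trace_fin_two]
  norm_num

lemma JU_one_smul_levelOne (b : Idx) (p p₁ p₂ : Polynomial ℂ) :
    JU b 1 • cls k j (levelOne p p₁ p₂) = cls k j (
      ((∑ c, fstr b .zero c • (JU c 0 * polyH p)) + (k * Kup b .zero) • polyH p) +
      ((∑ c, fstr b .plus c • (JU c 0 * (JU .minus 0 * polyH p₁))) +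
        (k * Kup b .plus) • (JU .minus 0 * polyH p₁)) +
      ((∑ c, fstr b .minus c • (JU c 0 * (JU .plus 0 * polyH p₂))) +
        (k * Kup b .minus) • (JU .plus 0 * polyH p₂))) := by
  have h0 := cls_JU_one_mul (k := k) (j := j) b .zero .zero 0 p
  have h1 := cls_JU_one_mul (k := k) (j := j) b .plus .minus 1 p₁
  have h2 := cls_JU_one_mul (k := k) (j := j) b .minus .plus 1 p₂
  rw [pow_zero, one_mul] at h0
  rw [pow_one] at h1 h2
  rw [← cls_mul, levelOne, mul_add, mul_add, cls_add, cls_add, h0, h1, h2, ← cls_add, ← cls_add]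

lemma cls_add_add_smul_congr (u : U) {v v' w w' : U} (c : ℂ) (hv : cls k j v = cls k j v')
    (hw : cls k j w = cls k j w') : cls k j (u + v + c • w) = cls k j (u + v' + c • w') := by
  rw [cls_add, cls_add, cls_smul, hv, hw, ← cls_smul, ← cls_add, ← cls_add]

lemma zero_one_smul_levelOne (p p₁ p₂ : Polynomial ℂ) :
    JU .zero 1 • cls k j (levelOne p p₁ p₂) = cls k j (polyH (Polynomial.C (k / 2) * p +
      (Polynomial.C (j * (j + 1)) + (Polynomial.X - Polynomial.X * Polynomial.X)) * p₁ -
      (Polynomial.C (j * (j + 1)) - (Polynomial.X + Polynomial.X * Polynomial.X)) * p₂)) := by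
  obtain ⟨h1, h2, h3, -⟩ := Kup_values
  have hL : ((∑ c, fstr .zero .zero c • (JU c 0 * polyH p)) + (k * (1 / 2)) • polyH p) +
      ((∑ c, fstr .zero .plus c • (JU c 0 * (JU .minus 0 * polyH p₁))) +
        (k * 0) • (JU .minus 0 * polyH p₁)) +
      ((∑ c, fstr .zero .minus c • (JU c 0 * (JU .plus 0 * polyH p₂))) +
        (k * 0) • (JU .plus 0 * polyH p₂)) =
      (k / 2) • polyH p + JU .plus 0 * (JU .minus 0 * polyH p₁) +
        (-1 : ℂ) • (JU .minus 0 * (JU .plus 0 * polyH p₂)) := by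
    simp only [sum_idx, fstr, zero_smul, mul_zero, add_zero, zero_add, one_smul]
    rw [mul_one_div]
  have hR : polyH (Polynomial.C (k / 2) * p +
      (Polynomial.C (j * (j + 1)) + (Polynomial.X - Polynomial.X * Polynomial.X)) * p₁ -
      (Polynomial.C (j * (j + 1)) - (Polynomial.X + Polynomial.X * Polynomial.X)) * p₂) =
      (k / 2) • polyH p + polyH ((Polynomial.C (j * (j + 1)) +
        (Polynomial.X - Polynomial.X * Polynomial.X)) * p₁) + (-1 : ℂ) • polyH
        ((Polynomial.C (j * (j + 1)) - (Polynomial.X + Polynomial.X * Polynomial.X)) * p₂) := by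
    rw [polyH_sub, polyH_add, polyH_smul, neg_one_smul, sub_eq_add_neg]
  rw [JU_one_smul_levelOne, h1, h2, h3, hL, hR]
  exact cls_add_add_smul_congr _ _ (cls_plus_minus_polyH p₁) (cls_minus_plus_polyH p₂)

lemma plus_one_smul_levelOne (p p₁ p₂ : Polynomial ℂ) :
    JU .plus 1 • cls k j (levelOne p p₁ p₂) = cls k j (JU .plus 0 *
      polyH ((Polynomial.C 2 * (Polynomial.X + Polynomial.C 1) + Polynomial.C k) * p₂ - p)) := by
  obtain ⟨-, -, -, h1, h2, h3, -⟩ := Kup_values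
  rw [JU_one_smul_levelOne, h1, h2, h3]
  congr 1
  simp only [sum_idx, fstr, zero_smul, mul_zero, add_zero, zero_add, one_smul, neg_smul,
    zero_mul_mul_polyH, charge, mul_one, Int.cast_one]
  rw [polyH_sub, add_mul (Polynomial.C 2 * _), mul_assoc (Polynomial.C 2), polyH_add, polyH_smul,
    polyH_smul, mul_sub, mul_add, mul_smul_comm, mul_smul_comm]
  abel

lemma minus_one_smul_levelOne (p p₁ p₂ : Polynomial ℂ) :
    JU .minus 1 • cls k j (levelOne p p₁ p₂) = cls k j (JU .minus 0 * polyH (p +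
      (Polynomial.C (-2) * (Polynomial.X + Polynomial.C (-1)) + Polynomial.C k) * p₁)) := by
  obtain ⟨-, -, -, -, -, -, h1, h2, h3⟩ := Kup_values
  rw [JU_one_smul_levelOne, h1, h2, h3]
  congr 1
  simp only [sum_idx, fstr, zero_smul, mul_zero, add_zero, zero_add, one_smul,
    zero_mul_mul_polyH, charge, mul_one, Int.cast_one, Int.cast_neg]
  rw [polyH_add, add_mul (Polynomial.C (-2) * _), mul_assoc (Polynomial.C (-2)), polyH_add,
    polyH_smul, polyH_smul, mul_add, mul_add, mul_smul_comm, mul_smul_comm]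

lemma quadratic_ne_zero (c b : ℂ) : (Polynomial.C c + (Polynomial.C b * Polynomial.X -
    Polynomial.X * Polynomial.X) : Polynomial ℂ) ≠ 0 := by
  intro h
  have h2 := congrArg (fun P => Polynomial.coeff P 2) h
  simp [← pow_two] at h2

/-- Applying `J^-_0` gives the class of a nonzero quadratic times `P` in `J^0_0`; that polynomial
must vanish, and polynomials have no zero divisors. -/
lemma eq_zero_of_cls_plus_polyH {P : Polynomial ℂ}
    (h : cls k j (JU .plus 0 * polyH P) = 0) : P = 0 := by
  have h1 := cls_minus_plus_polyH (k := k) (j := j) P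
  rw [cls_mul, h, smul_zero] at h1
  refine (mul_eq_zero.1 (eq_zero_of_cls_aeval_eq_zero h1.symm)).resolve_left ?_
  have h2 := quadratic_ne_zero (j * (j + 1)) (-1)
  rwa [Polynomial.C_neg, Polynomial.C_1, neg_one_mul, ← neg_add', ← sub_eq_add_neg] at h2

lemma eq_zero_of_cls_minus_polyH {P : Polynomial ℂ}
    (h : cls k j (JU .minus 0 * polyH P) = 0) : P = 0 := by
  have h1 := cls_plus_minus_polyH (k := k) (j := j) P
  rw [cls_mul, h, smul_zero] at h1
  refine (mul_eq_zero.1 (eq_zero_of_cls_aeval_eq_zero h1.symm)).resolve_left ?_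
  have h2 := quadratic_ne_zero (j * (j + 1)) 1
  rwa [Polynomial.C_1, one_mul] at h2

/-! ### The null operators -/

lemma T₁_mul_polyH (t : ℂ) (q : Polynomial ℂ) : T₁ t .zero * polyH q = levelOne
    ((Polynomial.C 2 * Polynomial.X + Polynomial.C t) *
      (Polynomial.C 2 * Polynomial.X - Polynomial.C t) * q)
    ((Polynomial.C 2 * Polynomial.X + Polynomial.C t) * q)
    ((Polynomial.C 2 * Polynomial.X - Polynomial.C t) * q) := by
  have hT : T₁ t .zero = levelOne
      ((Polynomial.C 2 * Polynomial.X + Polynomial.C t) *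
        (Polynomial.C 2 * Polynomial.X - Polynomial.C t))
      (Polynomial.C 2 * Polynomial.X + Polynomial.C t)
      (Polynomial.C 2 * Polynomial.X - Polynomial.C t) := by
    simp only [T₁, levelOne, fLow, sum_idx, Klow, fstr, polyH_mul, polyH_add, polyH_sub, polyH_C,
      polyH_X, Algebra.algebraMap_eq_smul_one]
    simp only [zero_smul, zero_mul, mul_zero, add_zero, zero_add, one_smul, mul_add, mul_sub,
      add_mul, smul_mul_assoc, mul_smul_comm, mul_one, one_mul, ← mul_assoc]
    module
  rw [hT, levelOne, levelOne, polyH_mul _ q, polyH_mul _ q, polyH_mul _ q]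
  simp only [add_mul (_ * _), add_mul (_ + _), mul_assoc]

lemma cls_mem_levelSpace (a b : Idx) (n : ℕ) (p : Polynomial ℂ) :
    cls k j (JU a (-1) * (JU b 0 ^ n * polyH p)) ∈ levelSpace k j 1 := by
  induction p using Polynomial.induction_on' with
  | add p q hp hq =>
    rw [polyH_add, mul_add, mul_add, map_add]; exact Submodule.add_mem _ hp hq
  | monomial m c =>
    rw [polyH, Polynomial.aeval_monomial, ← Algebra.smul_def, mul_smul_comm, mul_smul_comm,
      cls_smul]
    refine Submodule.smul_mem _ _ (Submodule.subset_span
      ⟨(a, -1) :: (List.replicate n (b, 0) ++ List.replicate m (.zero, 0)), ?_, ?_⟩)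
    · simp
    · simp

lemma levelOne_mem_levelSpace (p p₁ p₂ : Polynomial ℂ) :
    cls k j (levelOne p p₁ p₂) ∈ levelSpace k j 1 := by
  have h0 := cls_mem_levelSpace (k := k) (j := j) .zero .zero 0 p
  have h1 := cls_mem_levelSpace (k := k) (j := j) .plus .minus 1 p₁
  have h2 := cls_mem_levelSpace (k := k) (j := j) .minus .plus 1 p₂
  simp only [pow_zero, one_mul, pow_one] at h0 h1 h2
  rw [levelOne, map_add, map_add]
  exact Submodule.add_mem _ (Submodule.add_mem _ h0 h1) h2

lemma levelOne_mem_chargeSpace (p p₁ p₂ : Polynomial ℂ) :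
    cls k j (levelOne p p₁ p₂) ∈ chargeSpace k j 0 := by
  have h : ∀ (a b : Idx) (n : ℕ) (p : Polynomial ℂ), n * charge b + charge a = 0 →
      cls k j (JU a (-1) * (JU b 0 ^ n * polyH p)) ∈ chargeSpace k j 0 := by
    intro a b n p h
    refine Module.End.mem_eigenspace_iff.2 ?_
    rw [cls_mul, ad_JU_smul, ad_cls_pow_mul_polyH, smul_smul_comm, ← add_smul]
    congr 1
    exact_mod_cast h
  have h0 := h .zero .zero 0 p rfl
  have h1 := h .plus .minus 1 p₁ rfl
  have h2 := h .minus .plus 1 p₂ rfl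
  simp only [pow_zero, one_mul, pow_one] at h0 h1 h2
  rw [levelOne, map_add, map_add]
  exact Submodule.add_mem _ (Submodule.add_mem _ h0 h1) h2

/-- For `J^±_1` the cancellation is identical in `X` once `k = t - 2`; for `J^0_1` the `X²` terms
cancel for the same reason and the constant term cancels because `j (j + 1) = t (t - 2) / 4`. -/
lemma isNullOperator_T₁ {t : ℂ} (htk : t = k + 2) (hj : 2 * j * (j + 1) = t ^ 2 / 2 - t)
    (q : Polynomial ℂ) : IsNullOperator (cls k j (T₁ t .zero * polyH q)) := by
  obtain rfl : k = t - 2 := by rw [htk]; ring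
  have hj2 : j * (j + 1) = t * (t - 2) / 4 := by linear_combination hj / 2
  intro a
  rw [T₁_mul_polyH]
  cases a with
  | zero =>
    rw [zero_one_smul_levelOne, hj2]
    convert map_zero (cls (t - 2) j)
    rw [← polyH_zero]
    congr 1
    apply Polynomial.funext
    intro x
    simp
    ring
  | plus =>
    rw [plus_one_smul_levelOne]
    convert map_zero (cls (t - 2) j)
    rw [← mul_zero (JU .plus 0), ← polyH_zero]
    congr 2
    apply Polynomial.funext
    intro x
    simp
    ring
  | minus =>
    rw [minus_one_smul_levelOne]
    convert map_zero (cls (t - 2) j)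
    rw [← mul_zero (JU .minus 0), ← polyH_zero]
    congr 2
    apply Polynomial.funext
    intro x
    simp
    ring

/-- The conditions for `J^+_1` and `J^-_1` read `p = (2X + t) p₂` and `p = (2X - t) p₁`, and they
already force the shape of `T̂⁰₁ q`. -/
lemma exists_eq_T₁_mul_of_isNullOperator {t : ℂ} (htk : t = k + 2) (ht : t ≠ 0)
    {p p₁ p₂ : Polynomial ℂ} (hT : IsNullOperator (cls k j (levelOne p p₁ p₂))) :
    ∃ q, levelOne p p₁ p₂ = T₁ t .zero * polyH q := by
  obtain rfl : k = t - 2 := by rw [htk]; ring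
  have h1 := hT .plus
  have h2 := hT .minus
  rw [plus_one_smul_levelOne] at h1
  rw [minus_one_smul_levelOne] at h2
  have e1 := eq_zero_of_cls_plus_polyH h1
  have e2 := eq_zero_of_cls_minus_polyH h2
  -- Invertibility of `2t` is the Bézout relation for `2X + t` and `2X - t`, whose difference is
  -- `2t`.
  have hc : (Polynomial.C (1 / (2 * t)) * (Polynomial.C 2 * Polynomial.C t) : Polynomial ℂ) = 1 := by
    rw [← Polynomial.C_mul, ← Polynomial.C_mul, one_div_mul_cancel (by simpa using ht),
      Polynomial.C_1]
  simp only [Polynomial.C_sub, Polynomial.C_neg, Polynomial.C_1] at e1 e2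
  have hC2 : (Polynomial.C 2 : Polynomial ℂ) = 2 := rfl
  rw [hC2] at hc e1 e2
  -- If `p₁ = (2X + t) q` and `p₂ = (2X - t) q`, then `p₁ - p₂ = 2t q`, which dictates this witness.
  refine ⟨Polynomial.C (1 / (2 * t)) * (p₁ - p₂), ?_⟩
  rw [T₁_mul_polyH, hC2]
  have f2 : p₂ = (2 * Polynomial.X - Polynomial.C t) *
      (Polynomial.C (1 / (2 * t)) * (p₁ - p₂)) := by
    linear_combination (-p₂) * hc + Polynomial.C (1 / (2 * t)) * (e1 + e2)
  have f1 : p₁ = (2 * Polynomial.X + Polynomial.C t) *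
      (Polynomial.C (1 / (2 * t)) * (p₁ - p₂)) := by
    linear_combination (-p₁) * hc + Polynomial.C (1 / (2 * t)) * (e1 + e2)
  rw [mul_assoc, ← f1, ← f2]
  congr 1
  linear_combination -e1

end

end AffineSl2


theorem mainTheorem2 (k t j : ℂ) (htk : t = k + 2) (ht : t ≠ 0)
    (hj : 2 * j * (j + 1) = t ^ 2 / 2 - t) (T : AffineSl2.NullVectorSpace k j) :
    (T ∈ AffineSl2.levelSpace k j 1 ∧ T ∈ AffineSl2.chargeSpace k j 0 ∧
        AffineSl2.IsNullOperator T) ↔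
      ∃ p : Polynomial ℂ,
        T = AffineSl2.cls k j
          (AffineSl2.T₁ t AffineSl2.Idx.zero *
            Polynomial.aeval (AffineSl2.JU AffineSl2.Idx.zero 0) p) := by
  constructor
  · rintro ⟨h1, h2, h3⟩
    -- The charge is an integer in `homogSpan` and a complex number in `chargeSpace`, hence the cast
    -- of zero to be simplified.
    have h4 : T ∈ AffineSl2.homogSpan k j 1 0 :=
      AffineSl2.mem_homogSpan_of_mem_levelSpace h1 (by simpa using h2)
    obtain ⟨p, p₁, p₂, rfl⟩ := AffineSl2.exists_levelOne_of_mem h4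
    obtain ⟨q, hq⟩ := AffineSl2.exists_eq_T₁_mul_of_isNullOperator htk ht h3
    exact ⟨q, congrArg _ hq⟩
  · rintro ⟨q, rfl⟩
    refine ⟨?_, ?_, AffineSl2.isNullOperator_T₁ htk hj q⟩
    · have := AffineSl2.T₁_mul_polyH t q
      rw [AffineSl2.polyH] at this
      rw [this]
      exact AffineSl2.levelOne_mem_levelSpace _ _ _
    · have := AffineSl2.T₁_mul_polyH t q
      rw [AffineSl2.polyH] at this
      rw [this]
      exact AffineSl2.levelOne_mem_chargeSpace _ _ _
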